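/- Let $k$ be a field, $\Gamma$ a finite group, and $R$ a Hopf algebra in the category of (left) Yetter–Drinfeld modules over the group algebra $k\Gamma$, with coaction $\delta$. Let $P(R)=\{x\in R : \Delta(x)=1\otimes x+x\otimes 1\}$ be its space of primitive elements. Assume that $R$ is an ET-algebra, that is, the coradical of $R$ (the sum of its simple subcoalgebras) is $k1$ and $P(R)$ generates $R$ as an algebra, and assume that $\dim_k P(R)=2$. Then $R$ can be obtained from the abelian case: there are an abelian subgroup $\Gamma_1\le\Gamma$ such that $\delta(R)\subseteq k\Gamma_1\otimes R$ and $R$, with its action restricted to $\Gamma_1$, is a Hopf algebra in the category of Yetter–Drinfeld modules over $k\Gamma_1$, a group $\Gamma_2$, and an exact sequence of Hopf algebras $$k\longrightarrow R\# k\Gamma_1\overset{\iota}{\longrightarrow} R\# k\Gamma\overset{\pi}{\longrightarrow} k\Gamma_2\longrightarrow k,$$ where $R\# k\Gamma_1$ and $R\# k\Gamma$ are the bosonizations of $R$ and $\iota(r\# h)=r\# h$ is the inclusion. Here exactness of a sequence $k\to A\overset{\iota}{\to}C\overset{\pi}{\to}B\to k$ of Hopf algebras means that $\iota$ is injective, $\pi$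 is surjective, $\ker\pi=C\,\iota(A)^+=\iota(A)^+C$ with $\iota(A)^+=\iota(\ker\varepsilon_A)$, and $$\iota(A)=\{c\in C : (\mathrm{id}\otimes\pi)\Delta(c)=c\otimes 1\}=\{c\in C : (\pi\otimes\mathrm{id})\Delta(c)=1\otimes c\}.$$ -/

import Mathlib

open TensorProduct Coalgebra

universe u v w w'

noncomputable section

/-! ### Yetter-Drinfeld modules over a group algebra -/

/-- A (left-left) Yetter-Drinfeld module over the Hopf algebra `H = kΓ` with underlying vector
space `V`: a left `H`-module (a representation of `Γ`) which is also a left `H`-comodule, such that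
`δ (h • m) = h₁ m₍₋₁₎ S(h₃) ⊗ h₂ • m₍₀₎`. The last condition is linear in `h`, and for a group
element `h = g` it reads `δ (g • m) = g m₍₋₁₎ g⁻¹ ⊗ g • m₍₀₎`. -/
structure YDModule (k : Type u) (Γ : Type v) (V : Type w) [Field k] [Group Γ]
    [AddCommGroup V] [Module k V] where
  /-- the action of `Γ`, i.e. the `kΓ`-module structure -/
  act : Representation k Γ V
  /-- the coaction `δ` -/
  coact : V →ₗ[k] MonoidAlgebra k Γ ⊗[k] V
  coact_coassoc :
    coact.lTensor (MonoidAlgebra k Γ) ∘ₗ coact =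
      (TensorProduct.assoc k _ _ _).toLinearMap ∘ₗ
        (comul (R := k) (A := MonoidAlgebra k Γ)).rTensor V ∘ₗ coact
  coact_counit :
    (TensorProduct.lid k V).toLinearMap ∘ₗ
      (counit (R := k) (A := MonoidAlgebra k Γ)).rTensor V ∘ₗ coact = LinearMap.id
  coact_act : ∀ (g : Γ) (m : V),
    coact (act g m) =
      TensorProduct.map
        (LinearMap.mulLeft k (MonoidAlgebra.single g (1 : k)) ∘ₗ
          LinearMap.mulRight k (MonoidAlgebra.single g⁻¹ (1 : k)))
        (act g) (coact m)

/-- `(a ⊗ b) ⊗ (c ⊗ d) ↦ a ⊗ f (b ⊗ c) ⊗ d`, i.e. the map `id ⊗ f ⊗ id`. -/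
def middleMap (k : Type u) [Field k] (A D : Type*) {B C B' C' : Type*}
    [AddCommGroup A] [Module k A] [AddCommGroup B] [Module k B] [AddCommGroup C] [Module k C]
    [AddCommGroup D] [Module k D] [AddCommGroup B'] [Module k B'] [AddCommGroup C'] [Module k C']
    (f : B ⊗[k] C →ₗ[k] C' ⊗[k] B') :
    (A ⊗[k] B) ⊗[k] (C ⊗[k] D) →ₗ[k] (A ⊗[k] C') ⊗[k] (B' ⊗[k] D) :=
  (TensorProduct.assoc k A C' (B' ⊗[k] D)).symm.toLinearMap ∘ₗ
    LinearMap.lTensor A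
      ((TensorProduct.assoc k C' B' D).toLinearMap ∘ₗ f.rTensor D ∘ₗ
        (TensorProduct.assoc k B C D).symm.toLinearMap) ∘ₗ
    (TensorProduct.assoc k A B (C ⊗[k] D)).toLinearMap

namespace YDModule

variable {k : Type u} {Γ : Type v} [Field k] [Group Γ]
variable {V : Type w} [AddCommGroup V] [Module k V] {W : Type w'} [AddCommGroup W] [Module k W]

/-- The action as a linear map `kΓ ⊗ V → V`. -/
def actMap (X : YDModule k Γ V) : MonoidAlgebra k Γ ⊗[k] V →ₗ[k] V :=
  TensorProduct.lift X.act.asAlgebraHom.toLinearMap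

/-- The morphisms of the category of Yetter-Drinfeld modules: linear and colinear maps. -/
structure IsHom (X : YDModule k Γ V) (Y : YDModule k Γ W) (f : V →ₗ[k] W) : Prop where
  map_act : ∀ (g : Γ) (m : V), f (X.act g m) = Y.act g (f m)
  map_coact : Y.coact ∘ₗ f = f.lTensor (MonoidAlgebra k Γ) ∘ₗ X.coact

/-- The braiding `c (m ⊗ n) = m₍₋₁₎ • n ⊗ m₍₀₎`. -/
def braiding (X : YDModule k Γ V) (Y : YDModule k Γ W) : V ⊗[k] W →ₗ[k] W ⊗[k] V :=
  Y.actMap.rTensor V ∘ₗ (TensorProduct.rightComm k (MonoidAlgebra k Γ) V W).toLinearMap ∘ₗ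
    X.coact.rTensor W

theorem actMap_single (X : YDModule k Γ V) (g : Γ) (m : V) :
    X.actMap (MonoidAlgebra.single g 1 ⊗ₜ m) = X.act g m := by
  simp [actMap]

/-- `m` is homogeneous of degree `g`. -/
def IsHomog (X : YDModule k Γ V) (g : Γ) (m : V) : Prop :=
  X.coact m = MonoidAlgebra.single g 1 ⊗ₜ m

theorem IsHomog.act {X : YDModule k Γ V} {g : Γ} {m : V} (h : X.IsHomog g m) (x : Γ) :
    X.IsHomog (x * g * x⁻¹) (X.act x m) := by
  unfold IsHomog at *
  rw [X.coact_act, h]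
  simp [mul_assoc]

theorem exists_sum {Γ : Type v} (t : MonoidAlgebra k Γ ⊗[k] V) :
    ∃ f : Γ →₀ V, t = f.sum fun g m => MonoidAlgebra.single g (1 : k) ⊗ₜ[k] m := by
  induction t with
  | zero => exact ⟨0, by simp⟩
  | add x y hx hy =>
    obtain ⟨f, rfl⟩ := hx
    obtain ⟨f', rfl⟩ := hy
    exact ⟨f + f', by rw [Finsupp.sum_add_index'] <;> simp [tmul_add]⟩
  | tmul x m =>
    induction x using MonoidAlgebra.induction_linear with
    | zero => exact ⟨0, by simp⟩
    | add x y hx hy =>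
      obtain ⟨f, hx⟩ := hx
      obtain ⟨f', hy⟩ := hy
      refine ⟨f + f', ?_⟩
      rw [Finsupp.sum_add_index', add_tmul, hx, hy] <;> simp [tmul_add]
    | single g a =>
      refine ⟨Finsupp.single g (a • m), ?_⟩
      rw [Finsupp.sum_single_index (by simp), tmul_smul, smul_tmul']
      simp

theorem span_homog (X : YDModule k Γ V) :
    Submodule.span k {m | ∃ g, X.IsHomog g m} = ⊤ := by
  classical
  rw [eq_top_iff]
  intro v _
  obtain ⟨f, hf⟩ := exists_sum (X.coact v)
  have h1 := LinearMap.congr_fun X.coact_counit v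
  have h2 := LinearMap.congr_fun X.coact_coassoc v
  simp only [LinearMap.comp_apply, hf, Finsupp.sum, map_sum] at h1 h2
  simp only [LinearMap.lTensor_tmul, LinearMap.rTensor_tmul, MonoidAlgebra.comul_single,
    MonoidAlgebra.counit_single, CommSemiring.comul_apply, TensorProduct.map_tmul,
    MonoidAlgebra.lsingle_apply, LinearEquiv.coe_coe, TensorProduct.assoc_tmul,
    TensorProduct.lid_tmul, CommSemiring.counit_apply, one_smul, LinearMap.id_apply] at h1 h2
  rw [← h1]
  refine Submodule.sum_mem _ fun g hg => Submodule.subset_span ⟨g, ?_⟩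
  have h3 := congrArg ((TensorProduct.lid k _).toLinearMap ∘ₗ LinearMap.rTensor _
    (Finsupp.lapply g ∘ₗ (MonoidAlgebra.coeffLinearEquiv k).toLinearMap)) h2
  simp only [map_sum, LinearMap.comp_apply, LinearMap.rTensor_tmul, LinearEquiv.coe_coe,
    TensorProduct.lid_tmul, MonoidAlgebra.coeffLinearEquiv_apply, MonoidAlgebra.coeff_single,
    Finsupp.lapply_apply, Finsupp.single_apply, ite_smul, one_smul, zero_smul,
    Finset.sum_ite_eq', if_pos hg] at h3
  exact h3

theorem hom_ext {M : Type*} [AddCommGroup M] [Module k M] (X : YDModule k Γ V)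
    {f f' : V →ₗ[k] M} (h : ∀ g m, X.IsHomog g m → f m = f' m) : f = f' :=
  LinearMap.ext_on X.span_homog fun _ ⟨g, hg⟩ => h g _ hg

theorem hom_ext₂ {M : Type*} [AddCommGroup M] [Module k M] (X : YDModule k Γ V)
    (Y : YDModule k Γ W) {f f' : V ⊗[k] W →ₗ[k] M}
    (h : ∀ g m g' n, X.IsHomog g m → Y.IsHomog g' n → f (m ⊗ₜ n) = f' (m ⊗ₜ n)) : f = f' :=
  TensorProduct.ext <| X.hom_ext fun g m hm => Y.hom_ext fun g' n hn => h g m g' n hm hn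

theorem homog_induction₂ (X : YDModule k Γ V) (Y : YDModule k Γ W) {p : V ⊗[k] W → Prop}
    (zero : p 0) (add : ∀ x y, p x → p y → p (x + y)) (smul : ∀ (c : k) x, p x → p (c • x))
    (tmul : ∀ g m g' n, X.IsHomog g m → Y.IsHomog g' n → p (m ⊗ₜ n)) (t : V ⊗[k] W) : p t := by
  let N : Submodule k (V ⊗[k] W) :=
    { carrier := {t | p t}, add_mem' := fun hx hy => add _ _ hx hy, zero_mem' := zero,
      smul_mem' := fun c x hx => smul c x hx }
  have h : N.mkQ = 0 := hom_ext₂ X Y fun g m g' n hm hn => by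
    have : m ⊗ₜ n ∈ N := tmul g m g' n hm hn
    simpa [-Submodule.mem_mk] using (Submodule.Quotient.mk_eq_zero N).2 this
  have h' : t ∈ N := by
    rw [← N.ker_mkQ, h]
    simp
  exact h'

theorem braiding_homog (X : YDModule k Γ V) (Y : YDModule k Γ W) {g : Γ} {m : V}
    (hm : X.IsHomog g m) (n : W) : X.braiding Y (m ⊗ₜ n) = Y.act g n ⊗ₜ m := by
  unfold IsHomog at hm
  simp [braiding, hm, actMap_single]

/-- The tensor product of Yetter-Drinfeld modules: diagonal action and codiagonal coaction
`m ⊗ n ↦ m₍₋₁₎ n₍₋₁₎ ⊗ m₍₀₎ ⊗ n₍₀₎`. -/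
def tensorCoact (X : YDModule k Γ V) (Y : YDModule k Γ W) :
    V ⊗[k] W →ₗ[k] MonoidAlgebra k Γ ⊗[k] (V ⊗[k] W) :=
  (LinearMap.mul' k (MonoidAlgebra k Γ)).rTensor (V ⊗[k] W) ∘ₗ
    (TensorProduct.tensorTensorTensorComm k (MonoidAlgebra k Γ) V
      (MonoidAlgebra k Γ) W).toLinearMap ∘ₗ
    TensorProduct.map X.coact Y.coact

theorem tensorCoact_homog (X : YDModule k Γ V) (Y : YDModule k Γ W) {g g' : Γ} {m : V} {n : W}
    (hm : X.IsHomog g m) (hn : Y.IsHomog g' n) :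
    tensorCoact X Y (m ⊗ₜ n) = MonoidAlgebra.single (g * g') 1 ⊗ₜ (m ⊗ₜ n) := by
  unfold IsHomog at hm hn
  simp [tensorCoact, hm, hn]

/-- The tensor product of two Yetter-Drinfeld modules. -/
def tensor (X : YDModule k Γ V) (Y : YDModule k Γ W) : YDModule k Γ (V ⊗[k] W) where
  act := X.act.tprod Y.act
  coact := tensorCoact X Y
  coact_coassoc := by
    refine hom_ext₂ X Y fun g m g' n hm hn => ?_
    simp [tensorCoact_homog X Y hm hn]
  coact_counit := by
    refine hom_ext₂ X Y fun g m g' n hm hn => ?_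
    simp [tensorCoact_homog X Y hm hn]
  coact_act := fun x t => by
    refine LinearMap.congr_fun (f := tensorCoact X Y ∘ₗ (X.act.tprod Y.act) x)
      (g := TensorProduct.map _ _ ∘ₗ tensorCoact X Y) (hom_ext₂ X Y fun g m g' n hm hn => ?_) t
    simp [tensorCoact_homog X Y hm hn, tensorCoact_homog X Y (hm.act x) (hn.act x), mul_assoc]

variable (k Γ) in
/-- The unit object: `k` with trivial action and coaction. -/
def unit : YDModule k Γ k where
  act := Representation.trivial k Γ k
  coact := TensorProduct.mk k (MonoidAlgebra k Γ) k 1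
  coact_coassoc := by ext; simp [MonoidAlgebra.one_def]
  coact_counit := by ext; simp
  coact_act := fun g m => by simp [MonoidAlgebra.one_def]

end YDModule

/-! ### Hopf algebras in the Yetter-Drinfeld category -/

/-- A Hopf algebra in the category of Yetter-Drinfeld modules over `kΓ`: an algebra and coalgebra
`R` with a Yetter-Drinfeld structure such that all structure maps are morphisms in the category,
the counit and the comultiplication are algebra maps (for the braided product
`(m ⊗ m)(id ⊗ c ⊗ id)` of `R ⊗ R`), together with an antipode. -/
structure YDHopfAlgebra (k : Type u) (Γ : Type v) (R : Type w) [Field k] [Group Γ]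
    [Ring R] [Algebra k R] [Coalgebra k R] extends YDModule k Γ R where
  mul_isHom : (toYDModule.tensor toYDModule).IsHom toYDModule (LinearMap.mul' k R)
  one_isHom : (YDModule.unit k Γ).IsHom toYDModule (Algebra.linearMap k R)
  comul_isHom : toYDModule.IsHom (toYDModule.tensor toYDModule) (comul (R := k) (A := R))
  counit_isHom : toYDModule.IsHom (YDModule.unit k Γ) (counit (R := k) (A := R))
  counit_one : counit (R := k) (1 : R) = 1
  counit_mul : ∀ r s : R, counit (R := k) (r * s) = counit (R := k) r * counit (R := k) s
  comul_one : comul (R := k) (1 : R) = 1 ⊗ₜ 1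
  comul_mul :
    comul (R := k) (A := R) ∘ₗ LinearMap.mul' k R =
      TensorProduct.map (LinearMap.mul' k R) (LinearMap.mul' k R) ∘ₗ
        middleMap k R R (toYDModule.braiding toYDModule) ∘ₗ
        TensorProduct.map (comul (R := k) (A := R)) (comul (R := k) (A := R))
  antipode : R →ₗ[k] R
  antipode_isHom : toYDModule.IsHom toYDModule antipode
  mul_antipode_rTensor_comul :
    LinearMap.mul' k R ∘ₗ antipode.rTensor R ∘ₗ comul = Algebra.linearMap k R ∘ₗ counit
  mul_antipode_lTensor_comul :
    LinearMap.mul' k R ∘ₗ antipode.lTensor R ∘ₗ comul = Algebra.linearMap k R ∘ₗ counit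

namespace YDHopfAlgebra

variable {k : Type u} {Γ : Type v} {R : Type w} [Field k] [Group Γ]
  [Ring R] [Algebra k R] [Coalgebra k R]

/-- The map `h ⊗ s ↦ h₁ • s ⊗ h₂`. -/
def twist (B : YDHopfAlgebra k Γ R) :
    MonoidAlgebra k Γ ⊗[k] R →ₗ[k] R ⊗[k] MonoidAlgebra k Γ :=
  B.actMap.rTensor (MonoidAlgebra k Γ) ∘ₗ
    (TensorProduct.rightComm k (MonoidAlgebra k Γ) (MonoidAlgebra k Γ) R).toLinearMap ∘ₗ
    (comul (R := k) (A := MonoidAlgebra k Γ)).rTensor R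

/-- The map `r ⊗ h ↦ r₍₋₁₎ h ⊗ r₍₀₎`. -/
def cotwist (B : YDHopfAlgebra k Γ R) :
    R ⊗[k] MonoidAlgebra k Γ →ₗ[k] MonoidAlgebra k Γ ⊗[k] R :=
  (LinearMap.mul' k (MonoidAlgebra k Γ)).rTensor R ∘ₗ
    (TensorProduct.rightComm k (MonoidAlgebra k Γ) R (MonoidAlgebra k Γ)).toLinearMap ∘ₗ
    B.coact.rTensor (MonoidAlgebra k Γ)

/-- The multiplication `(r # h)(s # t) = r (h₁ • s) # h₂ t` of the bosonization. -/
def smashMul (B : YDHopfAlgebra k Γ R) :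
    (R ⊗[k] MonoidAlgebra k Γ) ⊗[k] (R ⊗[k] MonoidAlgebra k Γ) →ₗ[k]
      R ⊗[k] MonoidAlgebra k Γ :=
  TensorProduct.map (LinearMap.mul' k R) (LinearMap.mul' k (MonoidAlgebra k Γ)) ∘ₗ
    middleMap k R (MonoidAlgebra k Γ) B.twist

/-- The comultiplication `r # h ↦ (r₁ # (r₂)₍₋₁₎ h₁) ⊗ ((r₂)₍₀₎ # h₂)` of the bosonization. -/
def smashComul (B : YDHopfAlgebra k Γ R) :
    R ⊗[k] MonoidAlgebra k Γ →ₗ[k]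
      (R ⊗[k] MonoidAlgebra k Γ) ⊗[k] (R ⊗[k] MonoidAlgebra k Γ) :=
  middleMap k R (MonoidAlgebra k Γ) B.cotwist ∘ₗ
    TensorProduct.map (comul (R := k) (A := R)) (comul (R := k) (A := MonoidAlgebra k Γ))

/-- The counit `r # h ↦ ε(r) ε(h)` of the bosonization. -/
def smashCounit (_ : YDHopfAlgebra k Γ R) : R ⊗[k] MonoidAlgebra k Γ →ₗ[k] k :=
  LinearMap.mul' k k ∘ₗ
    TensorProduct.map (counit (R := k) (A := R)) (counit (R := k) (A := MonoidAlgebra k Γ))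

/-- The antipode of the bosonization, `r # h ↦ (1 # S(r₍₋₁₎ h)) (S_R(r₍₀₎) # 1)`. -/
def smashAntipode (B : YDHopfAlgebra k Γ R) :
    R ⊗[k] MonoidAlgebra k Γ →ₗ[k] R ⊗[k] MonoidAlgebra k Γ :=
  B.twist ∘ₗ
    TensorProduct.map (HopfAlgebra.antipode k (A := MonoidAlgebra k Γ)) B.antipode ∘ₗ B.cotwist

/-- The basic element `r # g` for a group element `g`. -/
abbrev el (_ : YDHopfAlgebra k Γ R) (r : R) (g : Γ) : R ⊗[k] MonoidAlgebra k Γ :=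
  r ⊗ₜ MonoidAlgebra.single g 1

theorem act_one (B : YDHopfAlgebra k Γ R) (g : Γ) : B.act g (1 : R) = 1 := by
  have := B.one_isHom.map_act g 1
  simpa [YDModule.unit] using this.symm

theorem act_mul (B : YDHopfAlgebra k Γ R) (g : Γ) (r s : R) :
    B.act g (r * s) = B.act g r * B.act g s := by
  have := B.mul_isHom.map_act g (r ⊗ₜ s)
  simpa [YDModule.tensor] using this.symm

theorem coact_one (B : YDHopfAlgebra k Γ R) : B.IsHomog 1 1 := by
  have := LinearMap.congr_fun B.one_isHom.map_coact 1
  simpa [YDModule.unit, YDModule.IsHomog, MonoidAlgebra.one_def] using this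

theorem twist_single (B : YDHopfAlgebra k Γ R) (g : Γ) (r : R) :
    B.twist (MonoidAlgebra.single g 1 ⊗ₜ r) = B.el (B.act g r) g := by
  simp [twist, YDModule.actMap_single]

theorem cotwist_homog (B : YDHopfAlgebra k Γ R) {g : Γ} {r : R} (h : B.IsHomog g r) (x : Γ) :
    B.cotwist (B.el r x) = MonoidAlgebra.single (g * x) 1 ⊗ₜ r := by
  unfold YDModule.IsHomog at h
  simp [cotwist, h]

theorem smashMul_el (B : YDHopfAlgebra k Γ R) (r s : R) (g h : Γ) :
    B.smashMul (B.el r g ⊗ₜ B.el s h) = B.el (r * B.act g s) (g * h) := by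
  simp [smashMul, middleMap, twist_single]

theorem ext_el {M : Type*} [AddCommGroup M] [Module k M] (B : YDHopfAlgebra k Γ R)
    {f f' : R ⊗[k] MonoidAlgebra k Γ →ₗ[k] M} (h : ∀ r g, f (B.el r g) = f' (B.el r g)) :
    f = f' := by
  ext r g
  exact h r g

theorem el_induction (B : YDHopfAlgebra k Γ R) {p : R ⊗[k] MonoidAlgebra k Γ → Prop}
    (zero : p 0) (add : ∀ x y, p x → p y → p (x + y)) (smul : ∀ (c : k) x, p x → p (c • x))
    (el : ∀ r g, p (B.el r g)) (t : R ⊗[k] MonoidAlgebra k Γ) : p t := by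
  induction t with
  | zero => exact zero
  | add x y hx hy => exact add x y hx hy
  | tmul r x =>
    induction x using MonoidAlgebra.induction_linear with
    | zero => simpa using zero
    | add x y hx hy => simpa [tmul_add] using add _ _ hx hy
    | single g a =>
      have := smul a _ (el r g)
      simpa [YDHopfAlgebra.el, ← tmul_smul] using this

theorem ext_el₂ {M : Type*} [AddCommGroup M] [Module k M] (B : YDHopfAlgebra k Γ R)
    {f f' : (R ⊗[k] MonoidAlgebra k Γ) ⊗[k] (R ⊗[k] MonoidAlgebra k Γ) →ₗ[k] M}
    (h : ∀ r g s h, f (B.el r g ⊗ₜ B.el s h) = f' (B.el r g ⊗ₜ B.el s h)) : f = f' := by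
  refine TensorProduct.ext' fun a b => ?_
  induction a using B.el_induction with
  | zero => simp
  | add x y hx hy => simp only [map_add, add_tmul, hx, hy]
  | smul a x hx => simp only [map_smul, ← smul_tmul', hx]
  | el r g =>
  induction b using B.el_induction with
  | zero => simp
  | add x y hx hy => simp only [map_add, tmul_add, hx, hy]
  | smul a x hx => simp only [map_smul, tmul_smul, hx]
  | el s x => exact h _ _ _ _

theorem ext_homog {M : Type*} [AddCommGroup M] [Module k M] (B : YDHopfAlgebra k Γ R)
    {f f' : R ⊗[k] MonoidAlgebra k Γ →ₗ[k] M}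
    (h : ∀ b r g, B.IsHomog b r → f (B.el r g) = f' (B.el r g)) :
    f = f' :=
  B.ext_el fun r g => LinearMap.congr_fun (f := f ∘ₗ (TensorProduct.mk k _ _).flip
    (MonoidAlgebra.single g (1 : k))) (g := f' ∘ₗ (TensorProduct.mk k _ _).flip
    (MonoidAlgebra.single g (1 : k))) (B.hom_ext fun b r hr => h b r g hr) r

theorem smashMul_assoc (B : YDHopfAlgebra k Γ R) (a b c : R ⊗[k] MonoidAlgebra k Γ) :
    B.smashMul (B.smashMul (a ⊗ₜ b) ⊗ₜ c) = B.smashMul (a ⊗ₜ B.smashMul (b ⊗ₜ c)) := by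
  have h : B.smashMul ∘ₗ B.smashMul.rTensor _ = B.smashMul ∘ₗ B.smashMul.lTensor _ ∘ₗ
      (TensorProduct.assoc k _ _ _).toLinearMap := by
    refine TensorProduct.ext_threefold fun a b c => ?_
    simp only [LinearMap.comp_apply, LinearMap.rTensor_tmul, LinearMap.lTensor_tmul,
      LinearEquiv.coe_coe, TensorProduct.assoc_tmul]
    induction a using B.el_induction with
    | zero => simp
    | add x y hx hy => simp only [map_add, add_tmul, hx, hy]
    | smul a x hx => simp only [map_smul, ← smul_tmul', hx]
    | el r g =>
    induction b using B.el_induction with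
    | zero => simp
    | add x y hx hy => simp only [map_add, add_tmul, tmul_add, hx, hy]
    | smul a x hx => simp only [map_smul, tmul_smul, ← smul_tmul', hx]
    | el s h =>
    induction c using B.el_induction with
    | zero => simp
    | add x y hx hy => simp only [map_add, tmul_add, hx, hy]
    | smul a x hx => simp only [map_smul, tmul_smul, hx]
    | el t x => simp [smashMul_el, act_mul, mul_assoc]
  exact LinearMap.congr_fun h ((a ⊗ₜ b) ⊗ₜ c)

theorem smul_smashMul (B : YDHopfAlgebra k Γ R) (c : k) (a b : R ⊗[k] MonoidAlgebra k Γ) :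
    B.smashMul ((c • a) ⊗ₜ b) = c • B.smashMul (a ⊗ₜ b) := by
  rw [← smul_tmul', map_smul]

theorem smashMul_smul (B : YDHopfAlgebra k Γ R) (c : k) (a b : R ⊗[k] MonoidAlgebra k Γ) :
    B.smashMul (a ⊗ₜ (c • b)) = c • B.smashMul (a ⊗ₜ b) := by
  rw [tmul_smul, map_smul]

theorem one_smashMul (B : YDHopfAlgebra k Γ R) (a : R ⊗[k] MonoidAlgebra k Γ) :
    B.smashMul (B.el 1 1 ⊗ₜ a) = a := by
  have h : B.smashMul ∘ₗ TensorProduct.mk k _ _ (B.el 1 1) = LinearMap.id := by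
    refine B.ext_el fun r g => ?_
    simp [smashMul_el]
  exact LinearMap.congr_fun h a

theorem smashMul_one (B : YDHopfAlgebra k Γ R) (a : R ⊗[k] MonoidAlgebra k Γ) :
    B.smashMul (a ⊗ₜ B.el 1 1) = a := by
  have h : B.smashMul ∘ₗ (TensorProduct.mk k _ _).flip (B.el 1 1) = LinearMap.id := by
    refine B.ext_el fun r g => ?_
    simp [smashMul_el, act_one]
  exact LinearMap.congr_fun h a

/-- Auxiliary map `r₁ ⊗ v ↦ (r₁ # v₍₋₁₎ g) ⊗ v₍₀₎`. -/
def auxA {V : Type*} [AddCommGroup V] [Module k V] (X : YDModule k Γ V) (R : Type*)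
    [AddCommGroup R] [Module k R] (g : Γ) : R ⊗[k] V →ₗ[k] (R ⊗[k] MonoidAlgebra k Γ) ⊗[k] V :=
  (TensorProduct.assoc k _ _ _).symm.toLinearMap ∘ₗ
    LinearMap.lTensor R
      ((LinearMap.mulRight k (MonoidAlgebra.single g (1 : k))).rTensor V ∘ₗ X.coact)

theorem auxA_homog {R : Type w} [AddCommGroup R] [Module k R] {V : Type*} [AddCommGroup V] [Module k V] (X : YDModule k Γ V) (g : Γ) (r : R)
    {b : Γ} {v : V} (h : X.IsHomog b v) :
    auxA X R g (r ⊗ₜ v) = (r ⊗ₜ MonoidAlgebra.single (b * g) 1) ⊗ₜ v := by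
  unfold YDModule.IsHomog at h
  simp [auxA, h]

/-- Auxiliary map `r₁ ⊗ r₂ ↦ (r₁ # (r₂)₍₋₁₎ g) ⊗ ((r₂)₍₀₎ # g)`. -/
def auxB (B : YDHopfAlgebra k Γ R) (g : Γ) :
    R ⊗[k] R →ₗ[k] (R ⊗[k] MonoidAlgebra k Γ) ⊗[k] (R ⊗[k] MonoidAlgebra k Γ) :=
  LinearMap.lTensor _ ((TensorProduct.mk k R (MonoidAlgebra k Γ)).flip
    (MonoidAlgebra.single g 1)) ∘ₗ auxA B.toYDModule R g

theorem auxB_homog (B : YDHopfAlgebra k Γ R) (g : Γ) (r : R) {b : Γ} {s : R}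
    (h : B.IsHomog b s) : B.auxB g (r ⊗ₜ s) = B.el r (b * g) ⊗ₜ B.el s g := by
  simp [auxB, auxA_homog _ _ _ h]

theorem smashComul_el (B : YDHopfAlgebra k Γ R) (r : R) (g : Γ) :
    B.smashComul (B.el r g) = B.auxB g (comul r) := by
  have h : middleMap k R (MonoidAlgebra k Γ) B.cotwist ∘ₗ (TensorProduct.mk k (R ⊗[k] R) (MonoidAlgebra k Γ ⊗[k] MonoidAlgebra k Γ)).flip
      (MonoidAlgebra.single g (1 : k) ⊗ₜ MonoidAlgebra.single g (1 : k)) = B.auxB g := by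
    refine YDModule.hom_ext₂ (M := (R ⊗[k] MonoidAlgebra k Γ) ⊗[k] (R ⊗[k] MonoidAlgebra k Γ))
      B.toYDModule B.toYDModule fun b r c s hr hs => ?_
    rw [auxB_homog _ _ _ hs]
    simp [middleMap, cotwist_homog B hs]
  rw [← h]
  simp [smashComul]

theorem counit_act (B : YDHopfAlgebra k Γ R) (g : Γ) (r : R) :
    counit (R := k) (B.act g r) = counit (R := k) r := by
  simpa [YDModule.unit] using B.counit_isHom.map_act g r

theorem counit_homog (B : YDHopfAlgebra k Γ R) {g : Γ} {r : R} (h : B.IsHomog g r) :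
    counit (R := k) r = 0 ∨ g = 1 := by
  classical
  have := LinearMap.congr_fun B.counit_isHom.map_coact r
  unfold YDModule.IsHomog at h
  simp only [YDModule.unit, LinearMap.comp_apply, h, LinearMap.lTensor_tmul,
    TensorProduct.mk_apply] at this
  have h2 := congrArg ((TensorProduct.lid k _).toLinearMap ∘ₗ LinearMap.rTensor _
    (Finsupp.lapply (1 : Γ) ∘ₗ (MonoidAlgebra.coeffLinearEquiv k).toLinearMap)) this
  by_cases hg : g = 1
  · exact Or.inr hg
  · left
    simpa [MonoidAlgebra.one_def, Finsupp.single_apply, hg] using h2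

theorem comul_homog (B : YDHopfAlgebra k Γ R) {g : Γ} {r : R} (h : B.IsHomog g r) :
    (B.tensor B.toYDModule).IsHomog g (comul r) := by
  have := LinearMap.congr_fun B.comul_isHom.map_coact r
  unfold YDModule.IsHomog at *
  simpa [h] using this

theorem antipode_homog (B : YDHopfAlgebra k Γ R) {g : Γ} {r : R} (h : B.IsHomog g r) :
    B.IsHomog g (B.antipode r) := by
  have := LinearMap.congr_fun B.antipode_isHom.map_coact r
  unfold YDModule.IsHomog at *
  simpa [h] using this

theorem tensor_homog (B : YDHopfAlgebra k Γ R) {g h : Γ} {r s : R} (hr : B.IsHomog g r)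
    (hs : B.IsHomog h s) : (B.tensor B.toYDModule).IsHomog (g * h) (r ⊗ₜ s) :=
  YDModule.tensorCoact_homog _ _ hr hs

theorem mul_homog (B : YDHopfAlgebra k Γ R) {g h : Γ} {r s : R} (hr : B.IsHomog g r)
    (hs : B.IsHomog h s) : B.IsHomog (g * h) (r * s) := by
  have := LinearMap.congr_fun B.mul_isHom.map_coact (r ⊗ₜ s)
  have h2 := B.tensor_homog hr hs
  unfold YDModule.IsHomog at *
  simpa [h2] using this

theorem smashComul_coassoc (B : YDHopfAlgebra k Γ R) :
    (TensorProduct.assoc k _ _ _).toLinearMap ∘ₗ B.smashComul.rTensor _ ∘ₗ B.smashComul =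
      B.smashComul.lTensor _ ∘ₗ B.smashComul := by
  refine B.ext_el (M := (R ⊗[k] MonoidAlgebra k Γ) ⊗[k] ((R ⊗[k] MonoidAlgebra k Γ) ⊗[k]
    (R ⊗[k] MonoidAlgebra k Γ))) fun r g => ?_
  let P : R ⊗[k] (R ⊗[k] R) →ₗ[k] (R ⊗[k] MonoidAlgebra k Γ) ⊗[k]
      ((R ⊗[k] MonoidAlgebra k Γ) ⊗[k] (R ⊗[k] MonoidAlgebra k Γ)) :=
    LinearMap.lTensor _ (B.auxB g) ∘ₗ auxA (B.tensor B.toYDModule) R g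
  have h1 : ∀ x, B.smashComul.lTensor _ (B.auxB g x) =
      P ((comul (R := k) (A := R)).lTensor R x) := by
    refine LinearMap.congr_fun (f := B.smashComul.lTensor _ ∘ₗ B.auxB g)
      (g := P ∘ₗ (comul (R := k) (A := R)).lTensor R) ?_
    refine YDModule.hom_ext₂ (M := (R ⊗[k] MonoidAlgebra k Γ) ⊗[k] ((R ⊗[k] MonoidAlgebra k Γ) ⊗[k]
      (R ⊗[k] MonoidAlgebra k Γ))) B.toYDModule B.toYDModule fun b r c s hr hs => ?_
    simp only [LinearMap.comp_apply, auxB_homog _ _ _ hs, LinearMap.lTensor_tmul, smashComul_el, P,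
      auxA_homog _ _ _ (B.comul_homog hs)]
  have h2 : ∀ x, TensorProduct.assoc k _ _ _ (B.smashComul.rTensor _ (B.auxB g x)) =
      P (TensorProduct.assoc k _ _ _ ((comul (R := k) (A := R)).rTensor R x)) := by
    refine LinearMap.congr_fun
      (f := (TensorProduct.assoc k _ _ _).toLinearMap ∘ₗ B.smashComul.rTensor _ ∘ₗ B.auxB g)
      (g := P ∘ₗ (TensorProduct.assoc k _ _ _).toLinearMap ∘ₗ
        (comul (R := k) (A := R)).rTensor R) ?_
    refine YDModule.hom_ext₂ (M := (R ⊗[k] MonoidAlgebra k Γ) ⊗[k] ((R ⊗[k] MonoidAlgebra k Γ) ⊗[k]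
      (R ⊗[k] MonoidAlgebra k Γ))) B.toYDModule B.toYDModule fun b r c s hr hs => ?_
    simp only [LinearMap.comp_apply, auxB_homog _ _ _ hs, LinearMap.rTensor_tmul, smashComul_el]
    generalize comul (R := k) r = y
    induction y using YDModule.homog_induction₂ B.toYDModule B.toYDModule with
    | zero => simp
    | add x y hx hy => simp only [map_add, add_tmul, hx, hy]
    | smul a x hx => simp only [map_smul, ← smul_tmul', hx]
    | tmul d m e n hm hn =>
      simp [P, auxB_homog _ _ _ hn, auxA_homog _ _ _ (B.tensor_homog hn hs), auxB_homog _ _ _ hs,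
        mul_assoc]
  simp only [LinearMap.comp_apply, smashComul_el, LinearEquiv.coe_coe]
  rw [h1, h2, Coalgebra.coassoc_apply]

theorem smash_counit_comul (B : YDHopfAlgebra k Γ R) :
    B.smashCounit.rTensor _ ∘ₗ B.smashComul = TensorProduct.mk k k (R ⊗[k] MonoidAlgebra k Γ) 1 := by
  refine B.ext_el (M := k ⊗[k] (R ⊗[k] MonoidAlgebra k Γ)) fun r g => ?_
  have h : ∀ x, B.smashCounit.rTensor _ (B.auxB g x) = LinearMap.lTensor k
      ((TensorProduct.mk k R (MonoidAlgebra k Γ)).flip (MonoidAlgebra.single g 1))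
        ((counit (R := k) (A := R)).rTensor R x) := by
    intro x
    induction x using YDModule.homog_induction₂ B.toYDModule B.toYDModule with
    | zero => simp
    | add x y hx hy => simp only [map_add, hx, hy]
    | smul a x hx => simp only [map_smul, hx]
    | tmul d m e n hm hn => simp [auxB_homog _ _ _ hn, smashCounit]
  simp only [LinearMap.comp_apply, smashComul_el]
  rw [h, Coalgebra.rTensor_counit_comul]
  simp

theorem smash_comul_counit (B : YDHopfAlgebra k Γ R) :
    B.smashCounit.lTensor _ ∘ₗ B.smashComul = (TensorProduct.mk k (R ⊗[k] MonoidAlgebra k Γ) k).flip 1 := by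
  refine B.ext_el (M := (R ⊗[k] MonoidAlgebra k Γ) ⊗[k] k) fun r g => ?_
  have h : ∀ x, B.smashCounit.lTensor _ (B.auxB g x) = LinearMap.rTensor k
      ((TensorProduct.mk k R (MonoidAlgebra k Γ)).flip (MonoidAlgebra.single g 1))
        ((counit (R := k) (A := R)).lTensor R x) := by
    intro x
    induction x using YDModule.homog_induction₂ B.toYDModule B.toYDModule with
    | zero => simp
    | add x y hx hy => simp only [map_add, hx, hy]
    | smul a x hx => simp only [map_smul, hx]
    | tmul d m e n hm hn =>
      rcases B.counit_homog hn with h | h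
      · simp [auxB_homog _ _ _ hn, smashCounit, h]
      · simp [auxB_homog _ _ _ hn, smashCounit, h]
  simp only [LinearMap.comp_apply, smashComul_el]
  rw [h, Coalgebra.lTensor_counit_comul]
  simp

theorem comul_act (B : YDHopfAlgebra k Γ R) (g : Γ) (r : R) :
    comul (R := k) (B.act g r) = TensorProduct.map (B.act g) (B.act g) (comul r) :=
  B.comul_isHom.map_act g r

theorem smashComul_mul (B : YDHopfAlgebra k Γ R) :
    B.smashComul ∘ₗ B.smashMul = TensorProduct.map B.smashMul B.smashMul ∘ₗ
      (TensorProduct.tensorTensorTensorComm k _ _ _ _).toLinearMap ∘ₗ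
      TensorProduct.map B.smashComul B.smashComul := by
  refine B.ext_el₂ (M := (R ⊗[k] MonoidAlgebra k Γ) ⊗[k] (R ⊗[k] MonoidAlgebra k Γ)) fun r g s h => ?_
  have key := LinearMap.congr_fun B.comul_mul (r ⊗ₜ B.act g s)
  simp only [LinearMap.comp_apply, LinearMap.mul'_apply, TensorProduct.map_tmul,
    comul_act] at key
  simp only [LinearMap.comp_apply, smashMul_el, smashComul_el, TensorProduct.map_tmul, key, LinearEquiv.coe_coe]
  generalize comul (R := k) r = x
  generalize comul (R := k) s = y
  induction x using YDModule.homog_induction₂ B.toYDModule B.toYDModule with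
  | zero => simp
  | add x x' hx hy => simp only [map_add, add_tmul, hx, hy]
  | smul a x hx => simp only [map_smul, ← smul_tmul', hx]
  | tmul d m e n hm hn =>
    induction y using YDModule.homog_induction₂ B.toYDModule B.toYDModule with
    | zero => simp
    | add x x' hx hy => simp only [map_add, tmul_add, hx, hy]
    | smul a x hx => simp only [map_smul, tmul_smul, hx]
    | tmul d' m' e' n' hm' hn' =>
      simp [middleMap, YDModule.braiding_homog _ _ hn, auxB_homog _ _ _ hn, auxB_homog _ _ _ hn',
        auxB_homog _ _ _ (B.mul_homog hn (hn'.act g)), smashMul_el, mul_assoc]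

theorem smashCounit_mul (B : YDHopfAlgebra k Γ R) :
    B.smashCounit ∘ₗ B.smashMul =
      LinearMap.mul' k k ∘ₗ TensorProduct.map B.smashCounit B.smashCounit := by
  refine B.ext_el₂ fun r g s h => ?_
  simp [smashMul_el, smashCounit, B.counit_mul, counit_act]

theorem smashAntipode_homog (B : YDHopfAlgebra k Γ R) {b : Γ} {r : R} (hr : B.IsHomog b r)
    (g : Γ) : B.smashAntipode (B.el r g) =
      B.el (B.act (b * g)⁻¹ (B.antipode r)) (b * g)⁻¹ := by
  simp only [smashAntipode, LinearMap.comp_apply, B.cotwist_homog hr, TensorProduct.map_tmul,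
    MonoidAlgebra.antipode_single, CommSemiring.antipode_eq_id, LinearMap.id_apply, twist_single]

theorem smash_antipode_left (B : YDHopfAlgebra k Γ R) :
    B.smashMul ∘ₗ B.smashAntipode.rTensor _ ∘ₗ B.smashComul =
      LinearMap.toSpanSingleton k _ (B.el 1 1) ∘ₗ B.smashCounit := by
  refine B.ext_homog fun b r g hr => ?_
  let Q : MonoidAlgebra k Γ ⊗[k] (R ⊗[k] R) →ₗ[k] R ⊗[k] MonoidAlgebra k Γ :=
    B.smashMul ∘ₗ (TensorProduct.mk k (R ⊗[k] MonoidAlgebra k Γ) (R ⊗[k] MonoidAlgebra k Γ)).flip (B.el 1 g) ∘ₗ B.twist ∘ₗ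
      TensorProduct.map (HopfAlgebra.antipode k (A := MonoidAlgebra k Γ) ∘ₗ
        LinearMap.mulRight k (MonoidAlgebra.single g 1))
        (LinearMap.mul' k R ∘ₗ B.antipode.rTensor R)
  have h : ∀ x, B.smashMul (B.smashAntipode.rTensor _ (B.auxB g x)) =
      Q (YDModule.tensorCoact B.toYDModule B.toYDModule x) := by
    intro x
    induction x using YDModule.homog_induction₂ B.toYDModule B.toYDModule with
    | zero => simp
    | add x y hx hy => simp only [map_add, hx, hy]
    | smul a x hx => simp only [map_smul, hx]
    | tmul d m e n hm hn =>
      rw [YDModule.tensorCoact_homog _ _ hm hn, auxB_homog _ _ _ hn]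
      simp [Q, smashAntipode_homog B hm, smashMul_el, twist_single, act_mul, act_one, mul_assoc]
  have h2 : YDModule.tensorCoact B.toYDModule B.toYDModule (comul r) =
    MonoidAlgebra.single b 1 ⊗ₜ comul r := B.comul_homog hr
  have h3 := LinearMap.congr_fun B.mul_antipode_rTensor_comul r
  simp only [LinearMap.comp_apply] at h3
  simp only [LinearMap.comp_apply, smashComul_el, h, h2]
  rcases B.counit_homog hr with h0 | rfl
  · simp [Q, h3, h0, smashCounit]
  · simp [Q, h3, smashCounit, twist_single, smashMul_el, act_one, Algebra.algebraMap_eq_smul_one]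

theorem smash_antipode_right (B : YDHopfAlgebra k Γ R) :
    B.smashMul ∘ₗ B.smashAntipode.lTensor _ ∘ₗ B.smashComul =
      LinearMap.toSpanSingleton k _ (B.el 1 1) ∘ₗ B.smashCounit := by
  refine B.ext_el fun r g => ?_
  have h : ∀ x, B.smashMul (B.smashAntipode.lTensor _ (B.auxB g x)) =
      B.el (LinearMap.mul' k R (B.antipode.lTensor R x)) 1 := by
    intro x
    induction x using YDModule.homog_induction₂ B.toYDModule B.toYDModule with
    | zero => simp
    | add x y hx hy => simp only [map_add, hx, hy, add_tmul]
    | smul a x hx => simp only [map_smul, hx, smul_tmul']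
    | tmul d m e n hm hn =>
      rw [auxB_homog _ _ _ hn]
      have h4 : B.act (e * g) (B.act (e * g)⁻¹ (B.antipode n)) = B.antipode n := by
        rw [← Module.End.mul_apply, ← map_mul, mul_inv_cancel, map_one, Module.End.one_apply]
      rw [LinearMap.lTensor_tmul, smashAntipode_homog B hn, smashMul_el, h4]
      simp
  have h3 := LinearMap.congr_fun B.mul_antipode_lTensor_comul r
  simp only [LinearMap.comp_apply] at h3
  simp only [LinearMap.comp_apply, smashComul_el, h, h3]
  simp [smashCounit, Algebra.algebraMap_eq_smul_one, ← smul_tmul']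

/-! ### The bosonization as a Hopf algebra -/

/-- The bosonization `R # kΓ`, with underlying vector space `R ⊗ kΓ`. -/
def Bosonization (_ : YDHopfAlgebra k Γ R) : Type _ := R ⊗[k] MonoidAlgebra k Γ

variable (B : YDHopfAlgebra k Γ R)

/-- The element `r # x` of the bosonization. -/
def smash (r : R) (x : MonoidAlgebra k Γ) : B.Bosonization := r ⊗ₜ[k] x

instance : AddCommGroup B.Bosonization :=
  inferInstanceAs (AddCommGroup (R ⊗[k] MonoidAlgebra k Γ))

instance : Module k B.Bosonization :=
  inferInstanceAs (Module k (R ⊗[k] MonoidAlgebra k Γ))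

instance : Ring B.Bosonization where
  __ := (inferInstance : AddCommGroup B.Bosonization)
  mul a b := B.smashMul (TensorProduct.tmul k (M := R ⊗[k] MonoidAlgebra k Γ)
    (N := R ⊗[k] MonoidAlgebra k Γ) a b)
  one := B.el 1 1
  mul_assoc := B.smashMul_assoc
  one_mul := B.one_smashMul
  mul_one := B.smashMul_one
  left_distrib a b c := (congrArg B.smashMul (tmul_add _ _ _)).trans (map_add _ _ _)
  right_distrib a b c := (congrArg B.smashMul (add_tmul _ _ _)).trans (map_add _ _ _)
  zero_mul a := (congrArg B.smashMul (zero_tmul _ _)).trans (map_zero _)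
  mul_zero a := (congrArg B.smashMul (tmul_zero _ _)).trans (map_zero _)

instance : Algebra k B.Bosonization :=
  Algebra.ofModule B.smul_smashMul B.smashMul_smul

instance : Coalgebra k B.Bosonization where
  comul := B.smashComul
  counit := B.smashCounit
  coassoc := B.smashComul_coassoc
  rTensor_counit_comp_comul := B.smash_counit_comul
  lTensor_counit_comp_comul := B.smash_comul_counit

theorem bosonization_comul_mul (a b : B.Bosonization) :
    comul (R := k) (a * b) = comul (R := k) a * comul (R := k) b := by
  have h := LinearMap.congr_fun (LinearMap.mul'_tensor (R := k) (A := B.Bosonization)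
    (B := B.Bosonization)) (comul (R := k) a ⊗ₜ comul (R := k) b)
  rw [LinearMap.mul'_apply] at h
  rw [h]
  have h2 : LinearMap.mul' k B.Bosonization = B.smashMul := TensorProduct.ext' fun _ _ => rfl
  rw [h2]
  exact LinearMap.congr_fun B.smashComul_mul (TensorProduct.tmul k
    (M := R ⊗[k] MonoidAlgebra k Γ) (N := R ⊗[k] MonoidAlgebra k Γ) a b)

instance : Bialgebra k B.Bosonization :=
  Bialgebra.mk' k B.Bosonization
    (by
      change B.smashCounit (B.el 1 1) = 1
      simp [smashCounit, B.counit_one])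
    (fun {a b} => LinearMap.congr_fun B.smashCounit_mul (TensorProduct.tmul k
      (M := R ⊗[k] MonoidAlgebra k Γ) (N := R ⊗[k] MonoidAlgebra k Γ) a b))
    (by
      change B.smashComul (B.el 1 1) = B.el 1 1 ⊗ₜ B.el 1 1
      rw [smashComul_el, B.comul_one, auxB_homog _ _ _ B.coact_one, mul_one])
    (B.bosonization_comul_mul _ _)

instance : HopfAlgebra k B.Bosonization where
  antipode := B.smashAntipode
  mul_antipode_rTensor_comul := by
    have h2 : LinearMap.mul' k B.Bosonization = B.smashMul := TensorProduct.ext' fun _ _ => rfl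
    have h3 : Algebra.linearMap k B.Bosonization =
        LinearMap.toSpanSingleton k _ (B.el 1 1) := LinearMap.ext fun _ => rfl
    rw [h2, h3]
    exact B.smash_antipode_left
  mul_antipode_lTensor_comul := by
    have h2 : LinearMap.mul' k B.Bosonization = B.smashMul := TensorProduct.ext' fun _ _ => rfl
    have h3 : Algebra.linearMap k B.Bosonization =
        LinearMap.toSpanSingleton k _ (B.el 1 1) := LinearMap.ext fun _ => rfl
    rw [h2, h3]
    exact B.smash_antipode_right

end YDHopfAlgebra

/-! ### Coradical, primitive elements, ET-algebras -/

section Coradical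

variable (k : Type u) {C : Type w} [Field k] [AddCommGroup C] [Module k C] [Coalgebra k C]

/-- `D` is a subcoalgebra: `Δ(D) ⊆ D ⊗ D`. -/
def IsSubcoalgebra (D : Submodule k C) : Prop :=
  D.map (comul (R := k) (A := C)) ≤ LinearMap.range (TensorProduct.map D.subtype D.subtype)

/-- `D` is a simple subcoalgebra: nonzero, with no subcoalgebras but `0` and itself. -/
def IsSimpleSubcoalgebra (D : Submodule k C) : Prop :=
  IsSubcoalgebra k D ∧ D ≠ ⊥ ∧ ∀ E ≤ D, IsSubcoalgebra k E → E = ⊥ ∨ E = D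

variable (C) in
/-- The coradical: the sum of all simple subcoalgebras. -/
def coradical : Submodule k C :=
  sSup {D | IsSimpleSubcoalgebra k D}

end Coradical

/-- The space of primitive elements `{x | Δ(x) = 1 ⊗ x + x ⊗ 1}`. -/
def primitives (k : Type u) (R : Type w) [Field k] [Ring R] [Algebra k R] [Coalgebra k R] :
    Submodule k R :=
  LinearMap.ker (comul (R := k) (A := R) -
    (TensorProduct.mk k R R 1 + (TensorProduct.mk k R R).flip 1))

/-! ### Extensions of Hopf algebras -/

/-- Exactness of a sequence `k → A --ι--> C --π--> B → k` of Hopf algebras: `ι` is injective, `π`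
is surjective, `ker π = C ι(A)⁺ = ι(A)⁺ C`, and `ι(A)` is the algebra of both right and left
`π`-coinvariants of `C`. -/
structure IsHopfExact (k : Type u) [Field k] {A B C : Type*} [Ring A] [HopfAlgebra k A]
    [Ring B] [HopfAlgebra k B] [Ring C] [HopfAlgebra k C]
    (ι : A →ₐc[k] C) (π : C →ₐc[k] B) : Prop where
  injective : Function.Injective ι
  surjective : Function.Surjective π
  ker_eq_left : ∀ c : C, π c = 0 ↔
    c ∈ Submodule.span k {x : C | ∃ (c' : C) (a : A), counit (R := k) a = 0 ∧ x = c' * ι a}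
  ker_eq_right : ∀ c : C, π c = 0 ↔
    c ∈ Submodule.span k {x : C | ∃ (c' : C) (a : A), counit (R := k) a = 0 ∧ x = ι a * c'}
  coinv_right : ∀ c : C, c ∈ Set.range ι ↔
    (π : C →ₗ[k] B).lTensor C (comul (R := k) c) = c ⊗ₜ 1
  coinv_left : ∀ c : C, c ∈ Set.range ι ↔
    (π : C →ₗ[k] B).rTensor C (comul (R := k) c) = 1 ⊗ₜ c

namespace YDHopfAlgebra

variable {k : Type u} {Γ : Type v} {R : Type w} [Field k] [Group Γ]
  [Ring R] [Algebra k R] [Coalgebra k R]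

/-- `R` is an ET-algebra: its coradical is `k 1`, and the primitive elements generate it as an
algebra. -/
def IsET (_ : YDHopfAlgebra k Γ R) : Prop :=
  coradical k R = Submodule.span k {(1 : R)} ∧
    Algebra.adjoin k (primitives k R : Set R) = ⊤

/-- `B₁` is the Hopf algebra `R`, with the same algebra and coalgebra structure, regarded in the
Yetter-Drinfeld category over `kΓ₁` for a subgroup `Γ₁` of `Γ`: the action is restricted to `Γ₁`,
and the coaction of `kΓ` is the one of `kΓ₁` followed by the inclusion `kΓ₁ ⊆ kΓ`. -/
def IsRestriction (B : YDHopfAlgebra k Γ R) {Γ₁ : Subgroup Γ} (B₁ : YDHopfAlgebra k Γ₁ R) : Prop :=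
  (∀ g : Γ₁, B₁.act g = B.act (g : Γ)) ∧
    B.coact = (MonoidAlgebra.mapDomainAlgHom k k Γ₁.subtype).toLinearMap.rTensor R ∘ₗ B₁.coact

/-- `R` can be obtained from the abelian case: there are an abelian subgroup `Γ₁` of `Γ` over which
`R` is a Yetter-Drinfeld Hopf algebra, a group `Γ₂`, and an exact sequence of Hopf algebras
`k → R # kΓ₁ → R # kΓ → kΓ₂ → k` whose first map is the inclusion `r # h ↦ r # h`. -/
def ObtainedFromAbelianCase (B : YDHopfAlgebra k Γ R) : Prop :=
  ∃ (Γ₁ : Subgroup Γ) (B₁ : YDHopfAlgebra k Γ₁ R) (Γ₂ : Type v) (_ : Group Γ₂)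
    (ι : B₁.Bosonization →ₐc[k] B.Bosonization)
    (π : B.Bosonization →ₐc[k] MonoidAlgebra k Γ₂),
    IsMulCommutative Γ₁ ∧
    B.IsRestriction B₁ ∧
    (∀ (r : R) (x : MonoidAlgebra k Γ₁),
      ι (B₁.smash r x) = B.smash r (MonoidAlgebra.mapDomainAlgHom k k Γ₁.subtype x)) ∧
    IsHopfExact k ι π

end YDHopfAlgebra
end

/-!
The primitive elements form a Yetter-Drinfeld submodule of `R`. As it has dimension two, at most two
degrees occur in it, and the set of these degrees is stable under conjugation. Conjugation by one of
the degrees fixes that degree and hence also the other one, so that they commute and generate an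
abelian normal subgroup `Γ₁`. Since the primitive elements generate `R`, all degrees of `R` lie in
`Γ₁`, and the coaction takes values in `kΓ₁ ⊗ R`.

For `Γ₁` normal, `r # g ↦ ε(r) gΓ₁` is a map of Hopf algebras onto `k[Γ / Γ₁]`. If all degrees of
`R` lie in `Γ₁`, both of the coactions it induces on `R # kΓ` are the grading by the class of `g`,
whose component of degree one is `R # kΓ₁`.
-/

noncomputable section

/-- For non-commuting `g, h ∈ S`, the elements `g`, `h`, `g * h * g⁻¹` of `S` are distinct. -/
theorem isMulCommutative_normalClosure_of_encard_le_two {G : Type*} [Group G] {S : Set G}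
    (hconj : ∀ x, ∀ g ∈ S, x * g * x⁻¹ ∈ S) (hcard : S.encard ≤ 2) :
    IsMulCommutative (Subgroup.normalClosure S) := by
  have hmem : ∀ x ∈ Group.conjugatesOfSet S, x ∈ S := fun x hx => by
    obtain ⟨g, hg, hgx⟩ := Group.mem_conjugatesOfSet_iff.1 hx
    obtain ⟨y, rfl⟩ := isConj_iff.1 hgx
    exact hconj y g hg
  refine Subgroup.isMulCommutative_closure fun g hg h hh => by_contra fun hne => ?_
  have hsub : ({g, h, g * h * g⁻¹} : Set G) ⊆ S := by
    simp [Set.insert_subset_iff, hmem g hg, hmem h hh, hconj g h (hmem h hh)]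
  have hthree : ({g, h, g * h * g⁻¹} : Set G).encard = 3 := by
    refine Set.encard_eq_three.2 ⟨g, h, g * h * g⁻¹, ?_, ?_, ?_, rfl⟩
    · rintro rfl
      exact hne rfl
    · intro hg_eq
      have hgh : g = h := by simpa [eq_mul_inv_iff_mul_eq] using hg_eq
      exact hne (by rw [hgh])
    · exact fun hh_eq => hne (mul_inv_eq_iff_eq_mul.1 hh_eq.symm)
  have := hthree.ge.trans ((Set.encard_le_encard hsub).trans hcard)
  norm_num at this

namespace YDModule

variable {k : Type u} {Γ : Type v} [Field k] [Group Γ]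
variable {V : Type w} [AddCommGroup V] [Module k V] {W : Type w'} [AddCommGroup W] [Module k W]
variable {X : YDModule k Γ V} {Y : YDModule k Γ W}

theorem IsHomog.add {g : Γ} {m n : V} (hm : X.IsHomog g m) (hn : X.IsHomog g n) :
    X.IsHomog g (m + n) := by
  unfold IsHomog at *
  rw [map_add, hm, hn, tmul_add]

theorem IsHomog.sub {g : Γ} {m n : V} (hm : X.IsHomog g m) (hn : X.IsHomog g n) :
    X.IsHomog g (m - n) := by
  unfold IsHomog at *
  rw [map_sub, hm, hn, tmul_sub]

theorem IsHomog.tensor {g h : Γ} {m : V} {n : W} (hm : X.IsHomog g m) (hn : Y.IsHomog h n) :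
    (X.tensor Y).IsHomog (g * h) (m ⊗ₜ n) :=
  tensorCoact_homog X Y hm hn

theorem act_injective (X : YDModule k Γ V) (g : Γ) : Function.Injective (X.act g) := by
  refine Function.LeftInverse.injective (g := X.act g⁻¹) fun m => ?_
  rw [← Module.End.mul_apply, ← map_mul, inv_mul_cancel, map_one, Module.End.one_apply]

/-- The projection of a Yetter-Drinfeld module onto its homogeneous elements of degree `g`, which
reads off the coefficient of `g` in the coaction. -/
def component (X : YDModule k Γ V) (g : Γ) : V →ₗ[k] V :=
  (TensorProduct.lid k V).toLinearMap ∘ₗ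
    (Finsupp.lapply g ∘ₗ (MonoidAlgebra.coeffLinearEquiv k).toLinearMap).rTensor V ∘ₗ X.coact

theorem IsHomog.component_self {g : Γ} {m : V} (hm : X.IsHomog g m) :
    X.component g m = m := by
  unfold IsHomog at hm
  simp [component, hm]

theorem IsHomog.component_of_ne {g h : Γ} {m : V} (hm : X.IsHomog g m) (hgh : g ≠ h) :
    X.component h m = 0 := by
  unfold IsHomog at hm
  simp [component, hm, hgh]

theorem isHomog_component (X : YDModule k Γ V) (g : Γ) (m : V) :
    X.IsHomog g (X.component g m) := by
  suffices X.coact ∘ₗ X.component g =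
      TensorProduct.mk k _ _ (MonoidAlgebra.single g 1) ∘ₗ X.component g from
    LinearMap.congr_fun this m
  refine X.hom_ext fun h m hm => ?_
  rcases eq_or_ne h g with rfl | hne
  · rw [LinearMap.comp_apply, LinearMap.comp_apply, hm.component_self]
    exact hm
  · simp [hm.component_of_ne hne]

theorem mem_span_range_component (X : YDModule k Γ V) (m : V) :
    m ∈ Submodule.span k (Set.range fun g => X.component g m) := by
  obtain ⟨f, hf⟩ := exists_sum (X.coact m)
  have hcomp : ∀ g, X.component g m = f g := fun g => by
    classical
    simp [component, hf, Finsupp.sum, Finsupp.single_apply, eq_comm]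
  have hsum : ∑ g ∈ f.support, f g = m := by
    simpa [hf, Finsupp.sum] using LinearMap.congr_fun X.coact_counit m
  have hmem : ∑ g ∈ f.support, f g ∈ Submodule.span k (Set.range fun g => X.component g m) :=
    Submodule.sum_mem _ fun g _ => Submodule.subset_span ⟨g, hcomp g⟩
  rwa [hsum] at hmem

theorem IsHom.isHomog {f : V →ₗ[k] W} (hf : X.IsHom Y f) {g : Γ} {m : V}
    (hm : X.IsHomog g m) : Y.IsHomog g (f m) := by
  unfold IsHomog at *
  rw [← LinearMap.comp_apply, hf.map_coact, LinearMap.comp_apply, hm, LinearMap.lTensor_tmul]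

theorem IsHom.of_isHomog {f : V →ₗ[k] W} (hact : ∀ g m, f (X.act g m) = Y.act g (f m))
    (hdeg : ∀ g m, X.IsHomog g m → Y.IsHomog g (f m)) : X.IsHom Y f where
  map_act := hact
  map_coact := X.hom_ext fun g m hm => by
    have hfm := hdeg g m hm
    unfold IsHomog at hm hfm
    rw [LinearMap.comp_apply, LinearMap.comp_apply, hm, hfm, LinearMap.lTensor_tmul]

theorem IsHom.map_component {f : V →ₗ[k] W} (hf : X.IsHom Y f) (g : Γ) (m : V) :
    f (X.component g m) = Y.component g (f m) := by
  suffices f ∘ₗ X.component g = Y.component g ∘ₗ f from LinearMap.congr_fun this m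
  refine X.hom_ext fun h n hn => ?_
  rw [LinearMap.comp_apply, LinearMap.comp_apply]
  rcases eq_or_ne h g with rfl | hne
  · rw [hn.component_self, (hf.isHomog hn).component_self]
  · rw [hn.component_of_ne hne, (hf.isHomog hn).component_of_ne hne, map_zero]

theorem IsHom.act_mem_ker {f : V →ₗ[k] W} (hf : X.IsHom Y f) (g : Γ) {m : V}
    (hm : m ∈ LinearMap.ker f) : X.act g m ∈ LinearMap.ker f := by
  rw [LinearMap.mem_ker] at *
  rw [hf.map_act, hm, map_zero]

theorem IsHom.component_mem_ker {f : V →ₗ[k] W} (hf : X.IsHom Y f) (g : Γ) {m : V}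
    (hm : m ∈ LinearMap.ker f) : X.component g m ∈ LinearMap.ker f := by
  rw [LinearMap.mem_ker] at *
  rw [hf.map_component, hm, map_zero]

theorem linearIndepOn_of_isHomog {s : Set Γ} {v : Γ → V}
    (hv : ∀ g ∈ s, X.IsHomog g (v g)) (hv₀ : ∀ g ∈ s, v g ≠ 0) : LinearIndepOn k v s := by
  rw [linearIndepOn_iff']
  intro t c hts hsum g hg
  have hcoeff : c g • v g = 0 := by
    have hcomp := congrArg (X.component g) hsum
    rw [map_sum, Finset.sum_eq_single_of_mem g hg, map_smul, (hv g (hts hg)).component_self,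
      map_zero] at hcomp
    · exact hcomp
    · intro h hh hne
      rw [map_smul, (hv h (hts hh)).component_of_ne hne, smul_zero]
  exact (smul_eq_zero.1 hcoeff).resolve_right (hv₀ g (hts hg))

/-- The degrees of the nonzero homogeneous elements of a subspace. -/
def degrees (X : YDModule k Γ V) (N : Submodule k V) : Set Γ :=
  {g | ∃ m : N, m ≠ 0 ∧ X.IsHomog g m}

theorem encard_degrees_le (X : YDModule k Γ V) (N : Submodule k V) :
    (X.degrees N).encard ≤ (Module.rank k N).toENat := by
  have hex : ∀ g ∈ X.degrees N, ∃ m : N, m ≠ 0 ∧ X.IsHomog g m := fun _ hg => hg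
  choose! v hv₀ hv using hex
  have hli : LinearIndepOn k (N.subtype ∘ v) (X.degrees N) :=
    linearIndepOn_of_isHomog hv fun g hg => by simpa using hv₀ g hg
  exact LinearIndepOn.encard_le_toENat_rank (LinearIndependent.of_comp N.subtype hli)

theorem conj_mem_degrees {N : Submodule k V} (hN : ∀ g, ∀ m ∈ N, X.act g m ∈ N) (x : Γ) {g : Γ}
    (hg : g ∈ X.degrees N) : x * g * x⁻¹ ∈ X.degrees N := by
  obtain ⟨m, hm₀, hm⟩ := hg
  refine ⟨⟨X.act x m, hN x m m.2⟩, fun h => hm₀ (Subtype.ext (X.act_injective x ?_)), hm.act x⟩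
  simpa using congrArg Subtype.val h

/-- The sum of the homogeneous components with degrees in `S`. -/
def homogSpan (X : YDModule k Γ V) (S : Set Γ) : Submodule k V :=
  Submodule.span k {m | ∃ g ∈ S, X.IsHomog g m}

theorem IsHomog.mem_homogSpan {S : Set Γ} {g : Γ} {m : V} (hm : X.IsHomog g m) (hg : g ∈ S) :
    m ∈ X.homogSpan S :=
  Submodule.subset_span ⟨g, hg, hm⟩

theorem homogSpan_mono (X : YDModule k Γ V) {S T : Set Γ} (hST : S ⊆ T) :
    X.homogSpan S ≤ X.homogSpan T :=
  Submodule.span_mono fun _ ⟨g, hg, hm⟩ => ⟨g, hST hg, hm⟩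

theorem le_homogSpan_degrees {N : Submodule k V} (hN : ∀ g, ∀ m ∈ N, X.component g m ∈ N) :
    N ≤ X.homogSpan (X.degrees N) := by
  refine fun m hm => Submodule.span_le.2 ?_ (X.mem_span_range_component m)
  rintro _ ⟨g, rfl⟩
  by_cases h₀ : X.component g m = 0
  · simp [h₀]
  · exact (X.isHomog_component g m).mem_homogSpan
      ⟨⟨_, hN g m hm⟩, by simpa using h₀, X.isHomog_component g m⟩

theorem hom_ext_of_homogSpan_eq_top {S : Set Γ} (hS : X.homogSpan S = ⊤) {f f' : V →ₗ[k] W}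
    (h : ∀ g ∈ S, ∀ m, X.IsHomog g m → f m = f' m) : f = f' :=
  LinearMap.ext_on hS fun m ⟨g, hg, hm⟩ => h g hg m hm

variable {Γ₁ : Subgroup Γ}

/-- The inclusion `kΓ₁ ⊆ kΓ`. -/
abbrev incl (k : Type u) [Field k] (Γ₁ : Subgroup Γ) : MonoidAlgebra k Γ₁ →ₗ[k] MonoidAlgebra k Γ :=
  (MonoidAlgebra.mapDomainAlgHom k k Γ₁.subtype).toLinearMap

theorem incl_single (g : Γ₁) (a : k) :
    incl k Γ₁ (MonoidAlgebra.single g a) = MonoidAlgebra.single (g : Γ) a := by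
  simp [incl]

theorem incl_injective : Function.Injective (incl k Γ₁) :=
  MonoidAlgebra.mapDomain_injective Γ₁.subtype_injective

/-- `X₁` is the Yetter-Drinfeld module `X` regarded over the subgroup `Γ₁`. -/
structure IsRestriction (X : YDModule k Γ V) (X₁ : YDModule k Γ₁ V) : Prop where
  act_eq : ∀ g : Γ₁, X₁.act g = X.act (g : Γ)
  coact_eq : X.coact = (incl k Γ₁).rTensor V ∘ₗ X₁.coact

section IsRestriction

variable {X₁ : YDModule k Γ₁ V} {Y₁ : YDModule k Γ₁ W}

theorem IsRestriction.isHomog (hX : X.IsRestriction X₁) {g : Γ₁} {m : V} (hm : X₁.IsHomog g m) :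
    X.IsHomog (g : Γ) m := by
  unfold IsHomog at *
  rw [hX.coact_eq, LinearMap.comp_apply, hm, LinearMap.rTensor_tmul, incl_single]

theorem IsRestriction.homogSpan_eq_top (hX : X.IsRestriction X₁) : X.homogSpan Γ₁ = ⊤ := by
  rw [eq_top_iff, ← X₁.span_homog, Submodule.span_le]
  rintro m ⟨g, hm⟩
  exact (hX.isHomog hm).mem_homogSpan g.2

theorem IsRestriction.tensor (hX : X.IsRestriction X₁) (hY : Y.IsRestriction Y₁) :
    (X.tensor Y).IsRestriction (X₁.tensor Y₁) where
  act_eq g := by simp [YDModule.tensor, Representation.tprod, hX.act_eq, hY.act_eq]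
  coact_eq := by
    refine hom_ext₂ X₁ Y₁ fun g m h n hm hn => ?_
    simp only [YDModule.tensor, LinearMap.comp_apply, tensorCoact_homog _ _ hm hn,
      tensorCoact_homog _ _ (hX.isHomog hm) (hY.isHomog hn), LinearMap.rTensor_tmul, incl_single,
      Subgroup.coe_mul]

theorem isRestriction_unit : (unit k Γ).IsRestriction (unit k Γ₁) where
  act_eq g := by ext; simp [unit]
  coact_eq := by ext; simp [unit, MonoidAlgebra.one_def]

theorem IsRestriction.isHom (hX : X.IsRestriction X₁) (hY : Y.IsRestriction Y₁) {f : V →ₗ[k] W}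
    (hf : X.IsHom Y f) : X₁.IsHom Y₁ f where
  map_act g m := by rw [hX.act_eq, hY.act_eq, hf.map_act]
  map_coact := by
    have hinj := Module.Flat.rTensor_preserves_injective_linearMap (M := W) (incl k Γ₁)
      incl_injective
    have hcoact := hf.map_coact
    rw [hX.coact_eq, hY.coact_eq, ← LinearMap.comp_assoc X₁.coact,
      LinearMap.lTensor_comp_rTensor, ← LinearMap.rTensor_comp_lTensor] at hcoact
    exact LinearMap.ext fun m => hinj (LinearMap.congr_fun hcoact m)

theorem IsRestriction.braiding_eq (hX : X.IsRestriction X₁) (hY : Y.IsRestriction Y₁) :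
    X₁.braiding Y₁ = X.braiding Y := by
  refine hom_ext₂ X₁ Y₁ fun g m _ n hm _ => ?_
  rw [braiding_homog _ _ hm, braiding_homog _ _ (hX.isHomog hm), hY.act_eq]

end IsRestriction

/-- The corestriction of the coaction to `kΓ₁`. It is meaningful when all degrees lie in `Γ₁`; then
the coaction takes values in `kΓ₁ ⊗ V`, so that the choice of a retraction `kΓ → kΓ₁` does not
matter. -/
def restrictCoact (X : YDModule k Γ V) (Γ₁ : Subgroup Γ) : V →ₗ[k] MonoidAlgebra k Γ₁ ⊗[k] V :=
  (incl k Γ₁).leftInverse.rTensor V ∘ₗ X.coact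

theorem IsHomog.restrictCoact {g : Γ₁} {m : V} (hm : X.IsHomog (g : Γ) m) :
    X.restrictCoact Γ₁ m = MonoidAlgebra.single g 1 ⊗ₜ m := by
  unfold IsHomog at hm
  rw [YDModule.restrictCoact, LinearMap.comp_apply, hm, LinearMap.rTensor_tmul, ← incl_single,
    LinearMap.leftInverse_apply_of_inj (LinearMap.ker_eq_bot.2 incl_injective)]

/-- The restriction to `Γ₁` of a Yetter-Drinfeld module with all degrees in `Γ₁`. -/
def restrict (X : YDModule k Γ V) (hX : X.homogSpan Γ₁ = ⊤) : YDModule k Γ₁ V where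
  act := X.act.comp Γ₁.subtype
  coact := X.restrictCoact Γ₁
  coact_coassoc := hom_ext_of_homogSpan_eq_top hX fun g hg m hm => by
    simp [IsHomog.restrictCoact (g := ⟨g, hg⟩) hm]
  coact_counit := hom_ext_of_homogSpan_eq_top hX fun g hg m hm => by
    simp [IsHomog.restrictCoact (g := ⟨g, hg⟩) hm]
  coact_act x m := by
    refine LinearMap.congr_fun (f := X.restrictCoact Γ₁ ∘ₗ X.act (x : Γ))
      (g := TensorProduct.map (LinearMap.mulLeft k (MonoidAlgebra.single x (1 : k)) ∘ₗ
        LinearMap.mulRight k (MonoidAlgebra.single x⁻¹ (1 : k))) (X.act (x : Γ)) ∘ₗ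
          X.restrictCoact Γ₁) (hom_ext_of_homogSpan_eq_top hX fun g hg m hm => ?_) m
    have hxm := IsHomog.restrictCoact (g := x * ⟨g, hg⟩ * x⁻¹) (hm.act (x : Γ))
    simp [IsHomog.restrictCoact (g := ⟨g, hg⟩) hm, hxm, mul_assoc]

theorem isRestriction_restrict (X : YDModule k Γ V) (hX : X.homogSpan Γ₁ = ⊤) :
    X.IsRestriction (X.restrict hX) where
  act_eq _ := rfl
  coact_eq := hom_ext_of_homogSpan_eq_top hX fun g hg m hm => by
    have hm₁ : (X.restrict hX).coact m = _ := IsHomog.restrictCoact (g := ⟨g, hg⟩) hm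
    rw [LinearMap.comp_apply, hm₁, LinearMap.rTensor_tmul, incl_single]
    exact hm

end YDModule

namespace YDHopfAlgebra

variable {k : Type u} {Γ : Type v} {R : Type w} [Field k] [Group Γ]
  [Ring R] [Algebra k R] [Coalgebra k R] {B : YDHopfAlgebra k Γ R} {Γ₁ : Subgroup Γ}
  {B₁ : YDHopfAlgebra k Γ₁ R}

/-- The restriction to `Γ₁` of a Yetter-Drinfeld Hopf algebra with all degrees in `Γ₁`. -/
def restrict (B : YDHopfAlgebra k Γ R) (hB : B.homogSpan Γ₁ = ⊤) : YDHopfAlgebra k Γ₁ R :=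
  have hres := B.toYDModule.isRestriction_restrict hB
  { toYDModule := B.toYDModule.restrict hB
    mul_isHom := (hres.tensor hres).isHom hres B.mul_isHom
    one_isHom := YDModule.isRestriction_unit.isHom hres B.one_isHom
    comul_isHom := hres.isHom (hres.tensor hres) B.comul_isHom
    counit_isHom := hres.isHom YDModule.isRestriction_unit B.counit_isHom
    counit_one := B.counit_one
    counit_mul := B.counit_mul
    comul_one := B.comul_one
    comul_mul := by rw [hres.braiding_eq hres, B.comul_mul]
    antipode := B.antipode
    antipode_isHom := hres.isHom hres B.antipode_isHom
    mul_antipode_rTensor_comul := B.mul_antipode_rTensor_comul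
    mul_antipode_lTensor_comul := B.mul_antipode_lTensor_comul }

theorem isRestriction_restrict (B : YDHopfAlgebra k Γ R) (hB : B.homogSpan Γ₁ = ⊤) :
    B.IsRestriction (B.restrict hB) :=
  have hres := B.toYDModule.isRestriction_restrict hB
  ⟨hres.act_eq, hres.coact_eq⟩

theorem IsRestriction.toYDModule (hB : B.IsRestriction B₁) :
    B.toYDModule.IsRestriction B₁.toYDModule :=
  ⟨hB.1, hB.2⟩

theorem isHom_comul_sub (B : YDHopfAlgebra k Γ R) :
    B.IsHom (B.tensor B.toYDModule) (comul (R := k) (A := R) -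
      (TensorProduct.mk k R R 1 + (TensorProduct.mk k R R).flip 1)) := by
  refine YDModule.IsHom.of_isHomog (fun g r => ?_) fun g r hr => ?_
  · simp [B.comul_act, YDModule.tensor, B.act_one]
  · refine (B.comul_homog hr).sub (.add ?_ ?_)
    · simpa using B.coact_one.tensor hr
    · simpa using hr.tensor B.coact_one

theorem act_mem_primitives (B : YDHopfAlgebra k Γ R) (g : Γ) {r : R} (hr : r ∈ primitives k R) :
    B.act g r ∈ primitives k R :=
  B.isHom_comul_sub.act_mem_ker g hr

theorem component_mem_primitives (B : YDHopfAlgebra k Γ R) (g : Γ) {r : R}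
    (hr : r ∈ primitives k R) : B.component g r ∈ primitives k R :=
  B.isHom_comul_sub.component_mem_ker g hr

/-- The subalgebra spanned by the homogeneous elements with degrees in `M`. -/
def homogSubalgebra (B : YDHopfAlgebra k Γ R) (M : Submonoid Γ) : Subalgebra k R :=
  (B.homogSpan M).toSubalgebra (B.coact_one.mem_homogSpan M.one_mem) fun r s hr hs => by
    have hmul : B.homogSpan M * B.homogSpan M ≤ B.homogSpan M := by
      rw [YDModule.homogSpan, Submodule.span_mul_span, Submodule.span_le]
      rintro _ ⟨a, ⟨g, hg, ha⟩, b, ⟨h, hh, hb⟩, rfl⟩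
      exact (B.mul_homog ha hb).mem_homogSpan (M.mul_mem hg hh)
    exact hmul (Submodule.mul_mem_mul hr hs)

theorem homogSpan_eq_top_of_adjoin_eq_top (B : YDHopfAlgebra k Γ R) {s : Set R}
    (hs : Algebra.adjoin k s = ⊤) {M : Submonoid Γ} (hsM : s ⊆ B.homogSpan M) :
    B.homogSpan M = ⊤ := by
  have htop : B.homogSubalgebra M = ⊤ := top_unique (hs ▸ Algebra.adjoin_le hsM)
  exact congrArg Subalgebra.toSubmodule htop

/-- The basic elements `r # g` of the bosonization for a group element `g`, linear in `r`. -/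
def smashSingle (B : YDHopfAlgebra k Γ R) (g : Γ) : R →ₗ[k] B.Bosonization :=
  (TensorProduct.mk k R (MonoidAlgebra k Γ)).flip (MonoidAlgebra.single g 1)

theorem bosonization_hom_ext {M : Type*} [AddCommGroup M] [Module k M]
    {f f' : B.Bosonization →ₗ[k] M}
    (h : ∀ r g, f (B.smashSingle g r) = f' (B.smashSingle g r)) : f = f' :=
  B.ext_el h

theorem smashSingle_mul_smashSingle (B : YDHopfAlgebra k Γ R) (r s : R) (g h : Γ) :
    B.smashSingle g r * B.smashSingle h s = B.smashSingle (g * h) (r * B.act g s) :=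
  B.smashMul_el r s g h

theorem smashSingle_one_one (B : YDHopfAlgebra k Γ R) : B.smashSingle 1 1 = 1 :=
  rfl

theorem counit_smashSingle (B : YDHopfAlgebra k Γ R) (r : R) (g : Γ) :
    counit (R := k) (B.smashSingle g r) = counit (R := k) r := by
  have h : counit (R := k) (B.smashSingle g r) = B.smashCounit (B.el r g) := rfl
  simp [h, smashCounit]

/-- The map `r ⊗ s ↦ (r # s₍₋₁₎ g) ⊗ (s₍₀₎ # g)`, which turns `Δ(r)` into `Δ(r # g)`. -/
def smashSingleTwist (B : YDHopfAlgebra k Γ R) (g : Γ) :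
    R ⊗[k] R →ₗ[k] B.Bosonization ⊗[k] B.Bosonization :=
  B.auxB g

theorem smashSingleTwist_tmul {b : Γ} {s : R} (hs : B.IsHomog b s) (g : Γ) (r : R) :
    B.smashSingleTwist g (r ⊗ₜ s) = B.smashSingle (b * g) r ⊗ₜ B.smashSingle g s :=
  B.auxB_homog g r hs

theorem comul_smashSingle (B : YDHopfAlgebra k Γ R) (r : R) (g : Γ) :
    comul (R := k) (B.smashSingle g r) = B.smashSingleTwist g (comul r) :=
  B.smashComul_el r g

theorem map_mul_of_smashSingle {A : Type*} [Ring A] [Algebra k A] (f : B.Bosonization →ₗ[k] A)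
    (hf : ∀ r g s h, f (B.smashSingle g r * B.smashSingle h s) =
      f (B.smashSingle g r) * f (B.smashSingle h s)) (x y : B.Bosonization) :
    f (x * y) = f x * f y := by
  suffices (LinearMap.mul k B.Bosonization).compr₂ f = (LinearMap.mul k A).compl₁₂ f f from
    LinearMap.congr_fun₂ this x y
  exact bosonization_hom_ext fun r g => bosonization_hom_ext fun s h => hf r g s h

/-- The linear map underlying the inclusion `R # kΓ₁ ⊆ R # kΓ`. -/
def inclusionLinearMap (B : YDHopfAlgebra k Γ R) (B₁ : YDHopfAlgebra k Γ₁ R) :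
    B₁.Bosonization →ₗ[k] B.Bosonization :=
  (YDModule.incl k Γ₁).lTensor R

theorem inclusionLinearMap_smashSingle (B : YDHopfAlgebra k Γ R) (B₁ : YDHopfAlgebra k Γ₁ R)
    (r : R) (g : Γ₁) :
    B.inclusionLinearMap B₁ (B₁.smashSingle g r) = B.smashSingle (g : Γ) r := by
  have h := LinearMap.lTensor_tmul R (YDModule.incl k Γ₁) r (MonoidAlgebra.single g 1)
  rwa [YDModule.incl_single] at h

theorem IsRestriction.map_inclusionLinearMap_comul (hB : B.IsRestriction B₁) :
    TensorProduct.map (B.inclusionLinearMap B₁) (B.inclusionLinearMap B₁) ∘ₗ comul =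
      comul ∘ₗ B.inclusionLinearMap B₁ := by
  refine bosonization_hom_ext fun r g => ?_
  have htwist : TensorProduct.map (B.inclusionLinearMap B₁) (B.inclusionLinearMap B₁) ∘ₗ
      B₁.smashSingleTwist g = B.smashSingleTwist (g : Γ) := by
    refine B₁.hom_ext₂ B₁.toYDModule fun _ r b s _ hs => ?_
    rw [LinearMap.comp_apply, smashSingleTwist_tmul hs, TensorProduct.map_tmul,
      smashSingleTwist_tmul (hB.toYDModule.isHomog hs)]
    simp only [inclusionLinearMap_smashSingle, Subgroup.coe_mul]
  rw [LinearMap.comp_apply, LinearMap.comp_apply, comul_smashSingle,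
    inclusionLinearMap_smashSingle, comul_smashSingle, ← htwist, LinearMap.comp_apply]

theorem counit_comp_inclusionLinearMap (B : YDHopfAlgebra k Γ R) (B₁ : YDHopfAlgebra k Γ₁ R) :
    counit ∘ₗ B.inclusionLinearMap B₁ = counit (R := k) :=
  bosonization_hom_ext fun r g => by
    simp only [LinearMap.comp_apply, inclusionLinearMap_smashSingle, counit_smashSingle]

/-- The inclusion `R # kΓ₁ ⊆ R # kΓ` of bialgebras. -/
def IsRestriction.inclusion (hB : B.IsRestriction B₁) : B₁.Bosonization →ₐc[k] B.Bosonization :=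
  .ofAlgHom
    (.ofLinearMap (B.inclusionLinearMap B₁)
      (by simp only [← smashSingle_one_one, inclusionLinearMap_smashSingle, Subgroup.coe_one])
      (map_mul_of_smashSingle _ fun r g s h => by
        simp only [smashSingle_mul_smashSingle, inclusionLinearMap_smashSingle, hB.1,
          Subgroup.coe_mul]))
    (AlgHom.toLinearMap_injective (B.counit_comp_inclusionLinearMap B₁))
    (AlgHom.toLinearMap_injective hB.map_inclusionLinearMap_comul)

theorem IsRestriction.inclusion_smash (hB : B.IsRestriction B₁) (r : R) (x : MonoidAlgebra k Γ₁) :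
    hB.inclusion (B₁.smash r x) =
      B.smash r (MonoidAlgebra.mapDomainAlgHom k k Γ₁.subtype x) :=
  LinearMap.lTensor_tmul R (YDModule.incl k Γ₁) r x

theorem IsRestriction.inclusion_smashSingle (hB : B.IsRestriction B₁) (r : R) (g : Γ₁) :
    hB.inclusion (B₁.smashSingle g r) = B.smashSingle (g : Γ) r :=
  B.inclusionLinearMap_smashSingle B₁ r g

theorem IsRestriction.inclusion_injective (hB : B.IsRestriction B₁) :
    Function.Injective hB.inclusion :=
  Module.Flat.lTensor_preserves_injective_linearMap (M := R) _ YDModule.incl_injective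

/-- The linear map `r # h ↦ ε(r) h` underlying the projection `R # kΓ → kΓ`. -/
def projectionLinearMap (B : YDHopfAlgebra k Γ R) : B.Bosonization →ₗ[k] MonoidAlgebra k Γ :=
  (TensorProduct.lid k _).toLinearMap ∘ₗ (counit (R := k) (A := R)).rTensor (MonoidAlgebra k Γ)

theorem projectionLinearMap_smashSingle (B : YDHopfAlgebra k Γ R) (r : R) (g : Γ) :
    B.projectionLinearMap (B.smashSingle g r) =
      counit (R := k) r • MonoidAlgebra.single g (1 : k) :=
  TensorProduct.lid_tmul (R := k) _ _

theorem lTensor_projectionLinearMap_comul (B : YDHopfAlgebra k Γ R) (r : R) (g : Γ) :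
    B.projectionLinearMap.lTensor B.Bosonization (comul (B.smashSingle g r)) =
      B.smashSingle g r ⊗ₜ MonoidAlgebra.single g 1 := by
  have htwist : B.projectionLinearMap.lTensor B.Bosonization ∘ₗ B.smashSingleTwist g =
      (TensorProduct.mk k B.Bosonization _).flip (MonoidAlgebra.single g 1) ∘ₗ
        B.smashSingle g ∘ₗ (TensorProduct.rid k R).toLinearMap ∘ₗ counit.lTensor R := by
    refine B.hom_ext₂ B.toYDModule fun _ r b s _ hs => ?_
    rcases B.counit_homog hs with hs₀ | rfl
    · simp [smashSingleTwist_tmul hs, projectionLinearMap_smashSingle, hs₀]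
    · simp [-MonoidAlgebra.smul_single, smashSingleTwist_tmul hs,
        projectionLinearMap_smashSingle]
  rw [comul_smashSingle, ← LinearMap.comp_apply, htwist]
  simp

theorem rTensor_projectionLinearMap_comul {b : Γ} {r : R} (hr : B.IsHomog b r) (g : Γ) :
    B.projectionLinearMap.rTensor B.Bosonization (comul (B.smashSingle g r)) =
      MonoidAlgebra.single (b * g) 1 ⊗ₜ B.smashSingle g r := by
  have htwist : B.projectionLinearMap.rTensor B.Bosonization ∘ₗ B.smashSingleTwist g =
      TensorProduct.map (LinearMap.mulRight k (MonoidAlgebra.single g 1)) (B.smashSingle g) ∘ₗ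
        B.coact ∘ₗ (TensorProduct.lid k R).toLinearMap ∘ₗ counit.rTensor R := by
    refine B.hom_ext₂ B.toYDModule fun _ r b s _ hs => ?_
    have hs' : B.coact s = _ := hs
    simp [smashSingleTwist_tmul hs, projectionLinearMap_smashSingle, hs', smul_tmul']
  have hr' : B.coact r = _ := hr
  rw [comul_smashSingle, ← LinearMap.comp_apply, htwist]
  simp [hr']

theorem map_projectionLinearMap_comul (B : YDHopfAlgebra k Γ R) :
    TensorProduct.map B.projectionLinearMap B.projectionLinearMap ∘ₗ comul =
      comul ∘ₗ B.projectionLinearMap := by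
  refine bosonization_hom_ext fun r g => ?_
  rw [← LinearMap.rTensor_comp_lTensor, LinearMap.comp_apply, LinearMap.comp_apply,
    lTensor_projectionLinearMap_comul]
  simp [-MonoidAlgebra.smul_single, projectionLinearMap_smashSingle, smul_tmul']

theorem counit_comp_projectionLinearMap (B : YDHopfAlgebra k Γ R) :
    counit ∘ₗ B.projectionLinearMap = counit (R := k) :=
  bosonization_hom_ext fun r g => by
    simp [projectionLinearMap_smashSingle, counit_smashSingle]

/-- The projection `R # kΓ → kΓ` of bialgebras. -/
def projection (B : YDHopfAlgebra k Γ R) : B.Bosonization →ₐc[k] MonoidAlgebra k Γ :=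
  .ofAlgHom
    (.ofLinearMap B.projectionLinearMap
      (by rw [← smashSingle_one_one, projectionLinearMap_smashSingle, B.counit_one, one_smul,
        MonoidAlgebra.one_def])
      (map_mul_of_smashSingle _ fun r g s h => by
        simp [smashSingle_mul_smashSingle, projectionLinearMap_smashSingle, B.counit_mul,
          B.counit_act, mul_comm]))
    (AlgHom.toLinearMap_injective B.counit_comp_projectionLinearMap)
    (AlgHom.toLinearMap_injective B.map_projectionLinearMap_comul)

section Exactness

variable {G : Type*} [Group G] {φ : Γ →* G}

/-- The map `r # g ↦ ε(r) φ(g)` of bialgebras induced by a group homomorphism `φ`. -/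
def projectionTo (B : YDHopfAlgebra k Γ R) (φ : Γ →* G) :
    B.Bosonization →ₐc[k] MonoidAlgebra k G :=
  (MonoidAlgebra.mapDomainBialgHom k φ).comp B.projection

theorem projectionTo_smashSingle (B : YDHopfAlgebra k Γ R) (φ : Γ →* G) (r : R) (g : Γ) :
    B.projectionTo φ (B.smashSingle g r) =
      counit (R := k) r • MonoidAlgebra.single (φ g) (1 : k) := by
  have h : B.projection (B.smashSingle g r) = _ := B.projectionLinearMap_smashSingle r g
  rw [projectionTo, BialgHom.comp_apply, h, map_smul, MonoidAlgebra.mapDomainBialgHom_single]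

theorem projectionTo_surjective (B : YDHopfAlgebra k Γ R) (hφ : Function.Surjective φ) :
    Function.Surjective (B.projectionTo φ) := by
  intro y
  induction y using MonoidAlgebra.induction_linear with
  | zero => exact ⟨0, map_zero _⟩
  | add y z hy hz =>
    obtain ⟨⟨c, rfl⟩, d, rfl⟩ := And.intro hy hz
    exact ⟨c + d, map_add ..⟩
  | single q a =>
    obtain ⟨g, rfl⟩ := hφ q
    exact ⟨B.smashSingle g (a • 1), by simp [projectionTo_smashSingle, B.counit_one]⟩

theorem lTensor_projectionTo_comul (B : YDHopfAlgebra k Γ R) (φ : Γ →* G) (r : R) (g : Γ) :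
    (B.projectionTo φ : B.Bosonization →ₗ[k] MonoidAlgebra k G).lTensor B.Bosonization
      (comul (B.smashSingle g r)) = B.smashSingle g r ⊗ₜ MonoidAlgebra.single (φ g) 1 := by
  have hcomp : (B.projectionTo φ : B.Bosonization →ₗ[k] MonoidAlgebra k G) =
    (MonoidAlgebra.mapDomainBialgHom k φ : _ →ₗ[k] _) ∘ₗ B.projectionLinearMap := rfl
  rw [hcomp, LinearMap.lTensor_comp, LinearMap.comp_apply, lTensor_projectionLinearMap_comul]
  simp

theorem rTensor_projectionTo_comul {b : Γ} {r : R} (hr : B.IsHomog b r) (hb : φ b = 1) (g : Γ) :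
    (B.projectionTo φ : B.Bosonization →ₗ[k] MonoidAlgebra k G).rTensor B.Bosonization
      (comul (B.smashSingle g r)) = MonoidAlgebra.single (φ g) 1 ⊗ₜ B.smashSingle g r := by
  have hcomp : (B.projectionTo φ : B.Bosonization →ₗ[k] MonoidAlgebra k G) =
    (MonoidAlgebra.mapDomainBialgHom k φ : _ →ₗ[k] _) ∘ₗ B.projectionLinearMap := rfl
  rw [hcomp, LinearMap.rTensor_comp, LinearMap.comp_apply, rTensor_projectionLinearMap_comul hr]
  simp [hb]

theorem counit_smashSingle_one_sub_smashSingle_one (B : YDHopfAlgebra k Γ R) (g h : Γ) :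
    counit (R := k) (B.smashSingle g 1 - B.smashSingle h 1) = 0 := by
  rw [map_sub, counit_smashSingle, counit_smashSingle, sub_self]

theorem mem_of_projectionTo_eq_zero (hφ : Function.Surjective φ) {N : Submodule k B.Bosonization}
    (haug : ∀ r g, counit (R := k) r = 0 → B.smashSingle g r ∈ N)
    (hcongr : ∀ g h, φ g = φ h → B.smashSingle g 1 - B.smashSingle h 1 ∈ N)
    {c : B.Bosonization} (hc : B.projectionTo φ c = 0) : c ∈ N := by
  let σ : MonoidAlgebra k G →ₗ[k] B.Bosonization :=
    TensorProduct.mk k R _ 1 ∘ₗ MonoidAlgebra.mapDomainLinearMap k k (Function.surjInv hφ)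
  have hσ : ∀ q, σ (MonoidAlgebra.single q 1) = B.smashSingle (Function.surjInv hφ q) 1 := fun q =>
    congrArg (B.smash 1) (MonoidAlgebra.mapDomainLinearMap_single ..)
  let π : B.Bosonization →ₗ[k] MonoidAlgebra k G := B.projectionTo φ
  have hmod : N.mkQ ∘ₗ σ ∘ₗ π = N.mkQ := by
    refine bosonization_hom_ext fun r g => ((Submodule.Quotient.eq N).2 ?_).symm
    have hsplit : B.smashSingle g r - σ (B.projectionTo φ (B.smashSingle g r)) =
        B.smashSingle g (r - counit (R := k) r • 1) + counit (R := k) r •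
          (B.smashSingle g 1 - B.smashSingle (Function.surjInv hφ (φ g)) 1) := by
      rw [projectionTo_smashSingle, map_smul, hσ, map_sub, map_smul, smul_sub]
      abel
    change B.smashSingle g r - σ (B.projectionTo φ (B.smashSingle g r)) ∈ N
    rw [hsplit]
    exact N.add_mem (haug _ _ (by simp [B.counit_one]))
      (N.smul_mem _ (hcongr _ _ (Function.surjInv_eq hφ _).symm))
  have hπc : π c = 0 := hc
  have hcN := LinearMap.congr_fun hmod c
  rw [LinearMap.comp_apply, LinearMap.comp_apply, hπc, map_zero, map_zero] at hcN
  exact (Submodule.Quotient.mk_eq_zero N).1 hcN.symm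

namespace IsRestriction

theorem projectionTo_inclusion (hB : B.IsRestriction B₁) (hker : φ.ker = Γ₁)
    (a : B₁.Bosonization) : B.projectionTo φ (hB.inclusion a) = algebraMap k _ (counit a) := by
  let ι : B₁.Bosonization →ₗ[k] B.Bosonization := hB.inclusion
  let π : B.Bosonization →ₗ[k] MonoidAlgebra k G := B.projectionTo φ
  suffices π ∘ₗ ι = Algebra.linearMap k _ ∘ₗ counit from LinearMap.congr_fun this a
  refine bosonization_hom_ext fun r g => ?_
  have hg : φ g = 1 := MonoidHom.mem_ker.1 (hker.ge g.2)
  have hπ := B.projectionTo_smashSingle φ r g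
  rw [← hB.inclusion_smashSingle, hg, ← MonoidAlgebra.one_def, ← Algebra.algebraMap_eq_smul_one]
    at hπ
  rw [LinearMap.comp_apply, LinearMap.comp_apply, counit_smashSingle]
  exact hπ

theorem projectionTo_eq_zero_iff_left (hB : B.IsRestriction B₁) (hφ : Function.Surjective φ)
    (hker : φ.ker = Γ₁) (c : B.Bosonization) :
    B.projectionTo φ c = 0 ↔ c ∈ Submodule.span k {x | ∃ (c' : B.Bosonization)
      (a : B₁.Bosonization), counit (R := k) a = 0 ∧ x = c' * hB.inclusion a} := by
  refine ⟨mem_of_projectionTo_eq_zero hφ (fun r g hr => Submodule.subset_span ?_)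
    fun g h hgh => Submodule.subset_span ?_, fun hc => ?_⟩
  · refine ⟨B.smashSingle g 1, B₁.smashSingle 1 (B.act g⁻¹ r), ?_, ?_⟩
    · rw [counit_smashSingle, B.counit_act, hr]
    · rw [inclusion_smashSingle, smashSingle_mul_smashSingle, ← Module.End.mul_apply, ← map_mul]
      simp
  · have hmem : h⁻¹ * g ∈ Γ₁ := by
      rw [← hker, MonoidHom.mem_ker, map_mul, map_inv, hgh, inv_mul_cancel]
    refine ⟨B.smashSingle h 1, _, B₁.counit_smashSingle_one_sub_smashSingle_one ⟨_, hmem⟩ 1, ?_⟩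
    simp [mul_sub, inclusion_smashSingle, smashSingle_mul_smashSingle, B.act_one]
  · let π : B.Bosonization →ₗ[k] MonoidAlgebra k G := B.projectionTo φ
    refine (Submodule.span_le (p := LinearMap.ker π)).2 ?_ hc
    rintro _ ⟨c', a, ha, rfl⟩
    change B.projectionTo φ _ = 0
    rw [map_mul, hB.projectionTo_inclusion hker, ha, map_zero, mul_zero]

theorem projectionTo_eq_zero_iff_right (hB : B.IsRestriction B₁) (hφ : Function.Surjective φ)
    (hker : φ.ker = Γ₁) (c : B.Bosonization) :
    B.projectionTo φ c = 0 ↔ c ∈ Submodule.span k {x | ∃ (c' : B.Bosonization)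
      (a : B₁.Bosonization), counit (R := k) a = 0 ∧ x = hB.inclusion a * c'} := by
  refine ⟨mem_of_projectionTo_eq_zero hφ (fun r g hr => Submodule.subset_span ?_)
    fun g h hgh => Submodule.subset_span ?_, fun hc => ?_⟩
  · refine ⟨B.smashSingle g 1, B₁.smashSingle 1 r, ?_, ?_⟩
    · rw [counit_smashSingle, hr]
    · simp [inclusion_smashSingle, smashSingle_mul_smashSingle]
  · have hmem : g * h⁻¹ ∈ Γ₁ := by
      rw [← hker, MonoidHom.mem_ker, map_mul, map_inv, hgh, mul_inv_cancel]
    refine ⟨B.smashSingle h 1, _, B₁.counit_smashSingle_one_sub_smashSingle_one ⟨_, hmem⟩ 1, ?_⟩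
    simp [sub_mul, inclusion_smashSingle, smashSingle_mul_smashSingle, B.act_one]
  · let π : B.Bosonization →ₗ[k] MonoidAlgebra k G := B.projectionTo φ
    refine (Submodule.span_le (p := LinearMap.ker π)).2 ?_ hc
    rintro _ ⟨c', a, ha, rfl⟩
    change B.projectionTo φ _ = 0
    rw [map_mul, hB.projectionTo_inclusion hker, ha, map_zero, zero_mul]

/-- `γ` is the grading of `R # kΓ` by `φ`, whose component in degree `1` is `R # kΓ₁`. -/
theorem mem_range_inclusion_iff (hB : B.IsRestriction B₁) (hker : φ.ker = Γ₁)
    {γ : B.Bosonization →ₗ[k] B.Bosonization ⊗[k] MonoidAlgebra k G}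
    (hγ : ∀ r g, γ (B.smashSingle g r) = B.smashSingle g r ⊗ₜ MonoidAlgebra.single (φ g) 1)
    (c : B.Bosonization) : c ∈ Set.range hB.inclusion ↔ γ c = c ⊗ₜ 1 := by
  let ι : B₁.Bosonization →ₗ[k] B.Bosonization := hB.inclusion
  have hmem : ∀ g : Γ, φ g = 1 ↔ g ∈ Γ₁ := fun g => by rw [← hker, MonoidHom.mem_ker]
  refine ⟨?_, fun hc => ?_⟩
  · rintro ⟨a, rfl⟩
    suffices γ ∘ₗ ι = (TensorProduct.mk k _ _).flip 1 ∘ₗ ι from LinearMap.congr_fun this a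
    refine bosonization_hom_ext fun r g => ?_
    have hι : ι (B₁.smashSingle g r) = _ := hB.inclusion_smashSingle r g
    simp [hι, hγ, (hmem g).2 g.2, MonoidAlgebra.one_def]
  · let p : B.Bosonization ⊗[k] MonoidAlgebra k G →ₗ[k] B.Bosonization :=
      (TensorProduct.rid k _).toLinearMap ∘ₗ
        (Finsupp.lapply 1 ∘ₗ (MonoidAlgebra.coeffLinearEquiv k).toLinearMap).lTensor _
    have hp : (LinearMap.range ι).mkQ ∘ₗ p ∘ₗ γ = 0 := bosonization_hom_ext fun r g => by
      refine (Submodule.Quotient.mk_eq_zero _).2 ?_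
      by_cases hg : g ∈ Γ₁
      · exact ⟨B₁.smashSingle ⟨g, hg⟩ r, by
          simp [p, hγ, (hmem g).2 hg, ι, inclusion_smashSingle]⟩
      · simp [p, hγ, mt (hmem g).1 hg]
    have hpc : p (γ c) = c := by simp [p, hc, MonoidAlgebra.one_def]
    have hcι := (Submodule.Quotient.mk_eq_zero _).1 (LinearMap.congr_fun hp c)
    rwa [LinearMap.comp_apply, hpc] at hcι

theorem isHopfExact (hB : B.IsRestriction B₁) (hφ : Function.Surjective φ) (hker : φ.ker = Γ₁) :
    IsHopfExact k hB.inclusion (B.projectionTo φ) where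
  injective := hB.inclusion_injective
  surjective := B.projectionTo_surjective hφ
  ker_eq_left := hB.projectionTo_eq_zero_iff_left hφ hker
  ker_eq_right := hB.projectionTo_eq_zero_iff_right hφ hker
  coinv_right := hB.mem_range_inclusion_iff hker
    (γ := (B.projectionTo φ : B.Bosonization →ₗ[k] MonoidAlgebra k G).lTensor _ ∘ₗ comul)
    (B.lTensor_projectionTo_comul φ)
  coinv_left c := by
    let γ : B.Bosonization →ₗ[k] B.Bosonization ⊗[k] MonoidAlgebra k G :=
      (TensorProduct.comm k _ _).toLinearMap ∘ₗ
        (B.projectionTo φ : B.Bosonization →ₗ[k] MonoidAlgebra k G).rTensor _ ∘ₗ comul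
    have hγ : ∀ g, γ ∘ₗ B.smashSingle g =
        (TensorProduct.mk k _ _).flip (MonoidAlgebra.single (φ g) 1) ∘ₗ B.smashSingle g :=
      fun g => YDModule.hom_ext_of_homogSpan_eq_top hB.toYDModule.homogSpan_eq_top
        fun b hb r hr => by
          have hb' : φ b = 1 := by rwa [← MonoidHom.mem_ker, hker]
          simp [γ, rTensor_projectionTo_comul hr hb']
    rw [hB.mem_range_inclusion_iff (γ := γ) hker fun r g => LinearMap.congr_fun (hγ g) r]
    exact (TensorProduct.comm k _ _).eq_symm_apply.symm

end IsRestriction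

end Exactness

theorem obtainedFromAbelianCase_of_homogSpan_eq_top (B : YDHopfAlgebra k Γ R) [Γ₁.Normal]
    [IsMulCommutative Γ₁] (hΓ₁ : B.homogSpan Γ₁ = ⊤) : B.ObtainedFromAbelianCase :=
  have hB := B.isRestriction_restrict hΓ₁
  ⟨Γ₁, B.restrict hΓ₁, Γ ⧸ Γ₁, inferInstance, hB.inclusion,
    B.projectionTo (QuotientGroup.mk' Γ₁), inferInstance, hB, hB.inclusion_smash,
    hB.isHopfExact (QuotientGroup.mk'_surjective Γ₁) (QuotientGroup.ker_mk' Γ₁)⟩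

end YDHopfAlgebra

theorem mainTheorem9_general {k : Type u} {Γ : Type v} {R : Type w} [Field k] [Group Γ]
    [Ring R] [Algebra k R] [Coalgebra k R] (B : YDHopfAlgebra k Γ R)
    (hgen : Algebra.adjoin k (primitives k R : Set R) = ⊤)
    (hdim : Module.rank k (primitives k R) ≤ 2) : B.ObtainedFromAbelianCase := by
  let S : Set Γ := B.degrees (primitives k R)
  have hS : S.encard ≤ 2 := (B.encard_degrees_le _).trans (Cardinal.toENat_le_ofNat.2 hdim)
  have hconj : ∀ x, ∀ g ∈ S, x * g * x⁻¹ ∈ S := fun x _ hg =>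
    YDModule.conj_mem_degrees (fun y _ hr => B.act_mem_primitives y hr) x hg
  have hcomm := isMulCommutative_normalClosure_of_encard_le_two hconj hS
  have hsub : (primitives k R : Set R) ⊆ B.homogSpan (Subgroup.normalClosure S) :=
    (YDModule.le_homogSpan_degrees fun g _ hr => B.component_mem_primitives g hr).trans
      (B.homogSpan_mono Subgroup.subset_normalClosure)
  exact B.obtainedFromAbelianCase_of_homogSpan_eq_top (Γ₁ := Subgroup.normalClosure S)
    (B.homogSpan_eq_top_of_adjoin_eq_top (M := (Subgroup.normalClosure S).toSubmonoid) hgen hsub)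

end

theorem mainTheorem9 {k : Type u} {Γ : Type v} {R : Type w} [Field k] [Group Γ] [Finite Γ]
    [Ring R] [Algebra k R] [Coalgebra k R] (B : YDHopfAlgebra k Γ R)
    (hET : B.IsET) (hdim : Module.finrank k (primitives k R) = 2) :
    B.ObtainedFromAbelianCase :=
  mainTheorem9_general B hET.2 ((Module.rank_eq_ofNat_iff_finrank_eq_ofNat 2).2 hdim).le
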